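/- Let $\alpha\in(0,2)$ and let $\mu_\alpha(v)=\frac1{2\pi}\int_{\mathbb R}\exp\big(iv\xi-\frac{|\xi|^\alpha}{\alpha}\big)\,d\xi$ be the symmetric $\alpha$-stable density on $\mathbb R$. For $h>0$ and $j\in\mathbb Z$ put $M_j=\mu_\alpha(jh)$. For real sequences $f=(f_j)_{j\in\mathbb Z}$, $g=(g_j)_{j\in\mathbb Z}$ let $$\|g\|_{\ell^2_h(M^{-1})}^2=\sum_{j\in\mathbb Z}g_j^2M_j^{-1}h,\qquad (D_hg)_j=\frac{g_{j+1}-g_{j-1}}{2h},\qquad (\Pi_hf)_j=M_j\,\frac{\sum_{k\in\mathbb Z}f_kh}{\sum_{k\in\mathbb Z}M_kh},$$ $$\mathcal S_\alpha^h(f,g)=\frac12\sum_{(j,k)\in\mathbb Z^2}\beta_k^h\Big(\frac{f_j}{M_j}-\frac{f_{j+k}}{M_{j+k}}\Big)\Big(\frac{g_j}{M_j}-\frac{g_{j+k}}{M_{j+k}}\Big)M_jh^2 .$$ Here $\beta^h_k$ are the Huang--Oberman weights of the discrete fractional Laplacian: $\beta_{-k}^h=\beta_k^h$, the value $\beta_0^h$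 is irrelevant, and, for $k\ge1$, $\beta_k^h=\frac{C_{1,\alpha}}{h^{1+\alpha}}\,b_k$ with $C_{1,\alpha}=\frac{2^\alpha\Gamma((\alpha+1)/2)}{\pi^{1/2}|\Gamma(-\alpha/2)|}$ and $$b_k=\begin{cases}\frac1{2-\alpha}-\varphi_\alpha''(1)-\frac{\varphi_\alpha'(3)+3\varphi_\alpha'(1)}2+\varphi_\alpha(3)-\varphi_\alpha(1)&k=1,\\ 2\big[\varphi_\alpha'(k+1)+\varphi_\alpha'(k-1)-\varphi_\alpha(k+1)+\varphi_\alpha(k-1)\big]&k\ge 2\text{ even},\\ -\frac{\varphi_\alpha'(k+2)+6\varphi_\alpha'(k)+\varphi_\alpha'(k-2)}2+\varphi_\alpha(k+2)-\varphi_\alpha(k-2)&k\ge3\text{ odd},\end{cases}$$ where $\varphi_\alpha(t)=\frac{t^{2-\alpha}}{(2-\alpha)(\alpha-1)\alpha}$ if $\alpha\ne1$ and $\varphi_1(t)=t-t\ln t$. Then there exist $\eta>0$ and $h_0>0$, depending only on $\alpha$, such that for every $\varepsilon\in(0,\eta)$ there is a constant $K(\varepsilon)>0$, depending only on $\alpha$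 and $\varepsilon$ (in particular not on $h$), such that for every $h\in(0,h_0)$ we have $M_j>0$ for all $j$ and $\sum_jM_j<\infty$, and for every real sequence $f$ with $\|f\|_{\ell^2_h(M^{-1})}<\infty$ all the sums below (including $\sum_kf_k$) converge absolutely and $$\|f\|_{\ell^2_h(M^{-1})}\|D_hf\|_{\ell^2_h(M^{-1})}+\|D_hf\|_{\ell^2_h(M^{-1})}^2\ \le\ K(\varepsilon)\Big(\mathcal S_\alpha^h(f,f)+\|\Pi_hf\|_{\ell^2_h(M^{-1})}^2\Big)+\varepsilon\,\mathcal S_\alpha^h(D_hf,D_hf).$$ -/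

import Mathlib

open MeasureTheory

noncomputable section

namespace LevyFP

/-- The Fourier integral `(2π)⁻¹ ∫ exp (i v ξ - |ξ|^α / α) dξ`, as a complex number. -/
def muC (α v : ℝ) : ℂ :=
  1 / (2 * (Real.pi : ℂ)) *
    ∫ ξ : ℝ, Complex.exp (Complex.I * (v : ℂ) * (ξ : ℂ) - ((|ξ| ^ α / α : ℝ) : ℂ))

/-- The one-dimensional local equilibrium `μ_α`, the symmetric `α`-stable density: the Fourier
integral `muC`, which is real (`muC_eq_mu`). -/
def mu (α v : ℝ) : ℝ := (muC α v).re

theorem conj_muC (α v : ℝ) : (starRingEnd ℂ) (muC α v) = muC α v := by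
  unfold muC
  rw [map_mul, ← integral_conj]
  congr 1
  · simp [Complex.conj_ofNat]
  · rw [← integral_neg_eq_self]
    congr 1
    ext ξ
    rw [← Complex.exp_conj]
    congr 1
    simp [abs_neg, Complex.conj_ofReal]

/-- The Fourier integral is real, so that no information is lost in `mu`. -/
theorem muC_eq_mu (α v : ℝ) : muC α v = (mu α v : ℂ) :=
  (Complex.conj_eq_iff_re.mp (conj_muC α v)).symm

/-- The discrete equilibrium `M_j = μ_α(v_j)`, with `v_j = j h`. -/
def M (α h : ℝ) (j : ℤ) : ℝ := mu α (j * h)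

/-- The constant `C_{1,α}` of the fractional Laplacian in dimension one. -/
def fracConst (α : ℝ) : ℝ :=
  2 ^ α * Real.Gamma ((α + 1) / 2) / (Real.sqrt Real.pi * |Real.Gamma (-(α / 2))|)

/-- The function `φ_α` (used for positive arguments only); its third derivative is
`t ^ (-1 - α)`. -/
def phi (α t : ℝ) : ℝ :=
  if α = 1 then t - t * Real.log t
  else t ^ (2 - α) / ((2 - α) * (α - 1) * α)

/-- The Huang–Oberman weights `β_k^h`. They are even in `k`. The value at `k = 0` is irrelevant
(it only ever multiplies `0`) and is set to `0`. -/
def beta (α h : ℝ) (k : ℤ) : ℝ :=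
  let n : ℕ := k.natAbs
  let x : ℝ := n
  fracConst α / h ^ (1 + α) *
    (if n = 0 then 0
    else if n = 1 then
      1 / (2 - α) - deriv (deriv (phi α)) 1 - (deriv (phi α) 3 + 3 * deriv (phi α) 1) / 2
        + phi α 3 - phi α 1
    else if Even n then
      2 * (deriv (phi α) (x + 1) + deriv (phi α) (x - 1) - phi α (x + 1) + phi α (x - 1))
    else
      -((deriv (phi α) (x + 2) + 6 * deriv (phi α) x + deriv (phi α) (x - 2)) / 2)
        + phi α (x + 2) - phi α (x - 2))

/-- Membership in the weighted space `ℓ²_h(γ)`. -/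
def MemEll2 (γ g : ℤ → ℝ) : Prop := Summable fun j : ℤ => g j ^ 2 * γ j

/-- The norm of `ℓ²_h(γ)`. -/
def ell2Norm (h : ℝ) (γ g : ℤ → ℝ) : ℝ := Real.sqrt (∑' j : ℤ, g j ^ 2 * γ j * h)

/-- The weight `M⁻¹`. -/
def Minv (α h : ℝ) (j : ℤ) : ℝ := (M α h j)⁻¹

/-- The centered finite difference operator `D_h`. -/
def D (h : ℝ) (g : ℤ → ℝ) (j : ℤ) : ℝ := (g (j + 1) - g (j - 1)) / (2 * h)

/-- The projection `Π_h` onto the span of the discrete equilibrium. -/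
def proj (α h : ℝ) (f : ℤ → ℝ) (j : ℤ) : ℝ :=
  M α h j * ((∑' k : ℤ, f k * h) / (∑' k : ℤ, M α h k * h))

/-- The `(j, k)` summand of `S_α^h (f, g)`, where `F = f / M` and `G = g / M`. -/
def symTerm (α h : ℝ) (f g : ℤ → ℝ) (p : ℤ × ℤ) : ℝ :=
  beta α h p.2 * ((f p.1 / M α h p.1 - f (p.1 + p.2) / M α h (p.1 + p.2)) *
    (g p.1 / M α h p.1 - g (p.1 + p.2) / M α h (p.1 + p.2))) * M α h p.1 * h ^ 2

/-- The symmetric part `S_α^h` of the discrete Lévy–Fokker–Planck operator. -/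
def symForm (α h : ℝ) (f g : ℤ → ℝ) : ℝ := 1 / 2 * ∑' p : ℤ × ℤ, symTerm α h f g p

end LevyFP

end

noncomputable section

namespace LevyFP

/-! Write F = f / M, a = ‖f‖ and d = ‖D_h f‖. By Young's inequality, a d + d² ≤ a²/2 + 3d²/2, so two
inequalities with constants independent of h suffice. One is a Poincaré inequality a² ≤ P (S(f,f) +
‖Π f‖²) (`exists_poincare`). The other is an interpolation inequality d² ≤ K δ^α S(D_h f, D_h f) + K
δ⁻² a² for every δ ∈ (0,1] (`exists_interpolation`). Taking δ^α small compared with ε and bounding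
the remaining a² by Poincaré gives the claim.

Poincaré: the sum of M_j M_l (F_j − F_l)² over all pairs is twice (∑ M)(∑ f²/M) − (∑ f)². It is
dominated by the Dirichlet form as soon as M_j M_l ≤ A β_{l−j} (M_j + M_l).

Interpolation: average G = D_h f / M over the R ≈ δ/h points to the right of j. The deviations of G
are paid for by the jumps of length at most δ in S(D_h f, D_h f). The M-weighted average itself is a
sum of centred differences of f, which telescopes to four boundary values divided by h.

Both arguments need only two facts, uniform in h: β_k is comparable to (|k| h)^(−1−α)
(`beta_bounds`), and μ_α is comparable to max(1,|v|)^(−1−α) (`mu_bounds`).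

The weights are integrals of quadratic Lagrange basis functions against t^(−1−α), apart from an
extra positive term at k = 1. The even ones are integrals of positive functions. The odd ones
involve a sign-changing function, and their positivity comes from explicit comparisons, tightest at
k = 3.

For the density, split the Lévy measure |y|^(−1−α) into a bounded integrable part `tailWeight` and a
part supported in [−1,1]. The large jumps form a compound Poisson factor. Since `tailWeight`
convolved with itself is at most a multiple of itself, its exponential series can be bounded term by
term, and the one-jump term alone gives the lower bound. The small-jump factor has a Schwartz
characteristic function, hence a rapidly decaying density. That density is nonnegative as a limit of
Gaussian-smoothed compound Poisson densities. -/

/-! ### Integral formulas for the Huang–Oberman weights. -/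

/-- The derivative of `phi α`. -/
def phiDeriv (α t : ℝ) : ℝ :=
  if α = 1 then -Real.log t else t ^ (1 - α) / ((α - 1) * α)

theorem hasDerivAt_phi {α : ℝ} (h2 : α < 2) {t : ℝ} (ht : 0 < t) :
    HasDerivAt (phi α) (phiDeriv α t) t := by
  by_cases h1 : α = 1
  · have e : phi α = fun t => t - t * Real.log t := by
      funext t; simp [phi, h1]
    rw [e]
    have := (hasDerivAt_id t).sub ((hasDerivAt_id t).mul (Real.hasDerivAt_log ht.ne'))
    refine this.congr_deriv ?_
    simp [phiDeriv, h1, ht.ne']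
  · have e : phi α = fun t => t ^ (2 - α) / ((2 - α) * (α - 1) * α) := by
      funext t; simp [phi, h1]
    rw [e]
    have := (Real.hasDerivAt_rpow_const (p := 2 - α) (Or.inl ht.ne')).div_const
      ((2 - α) * (α - 1) * α)
    refine this.congr_deriv ?_
    have h3 : (2 - α) ≠ 0 := by linarith
    rw [phiDeriv, if_neg h1, show (2 - α - 1) = 1 - α by ring, mul_assoc (2 - α),
      mul_div_mul_left _ _ h3]

theorem hasDerivAt_phiDeriv {α : ℝ} (h0 : 0 < α) {t : ℝ} (ht : 0 < t) :
    HasDerivAt (phiDeriv α) (-(t ^ (-α)) / α) t := by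
  by_cases h1 : α = 1
  · have e : phiDeriv α = fun t => -Real.log t := by
      funext t; simp [phiDeriv, h1]
    rw [e]
    refine (Real.hasDerivAt_log ht.ne').neg.congr_deriv ?_
    simp [h1, Real.rpow_neg_one]
  · have e : phiDeriv α = fun t => t ^ (1 - α) / ((α - 1) * α) := by
      funext t; simp [phiDeriv, h1]
    rw [e]
    refine ((Real.hasDerivAt_rpow_const (p := 1 - α) (Or.inl ht.ne')).div_const
      ((α - 1) * α)).congr_deriv ?_
    have h3 : (α - 1) ≠ 0 := sub_ne_zero.2 h1
    rw [show (1 - α - 1) = - α by ring]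
    field_simp
    ring

theorem hasDerivAt_phiDeriv2 {α : ℝ} (h0 : 0 < α) {t : ℝ} (ht : 0 < t) :
    HasDerivAt (fun t : ℝ => -(t ^ (-α)) / α) (t ^ (-1 - α)) t := by
  refine ((Real.hasDerivAt_rpow_const (p := -α) (Or.inl ht.ne')).neg.div_const
      α).congr_deriv ?_
  rw [show (-α - 1) = - 1 - α by ring]
  field_simp

theorem deriv_phi {α : ℝ} (h2 : α < 2) {t : ℝ} (ht : 0 < t) :
    deriv (phi α) t = phiDeriv α t := (hasDerivAt_phi h2 ht).deriv

theorem deriv_deriv_phi_one {α : ℝ} (h0 : 0 < α) (h2 : α < 2) :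
    deriv (deriv (phi α)) 1 = -(1 : ℝ) ^ (-α) / α := by
  have : deriv (phi α) =ᶠ[nhds 1] phiDeriv α := by
    filter_upwards [lt_mem_nhds (zero_lt_one (α := ℝ))] with t ht using deriv_phi h2 ht
  rw [this.deriv_eq, (hasDerivAt_phiDeriv h0 one_pos).deriv]

theorem continuousOn_rpow_comp {f : ℝ → ℝ} {s : Set ℝ} {r : ℝ} (hf : ContinuousOn f s)
    (hs : ∀ x ∈ s, 0 < f x) : ContinuousOn (fun x => f x ^ r) s :=
  hf.rpow_const fun x hx => Or.inl (hs x hx).ne'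

/-- Integration by parts against a quadratic weight, to the right of `k`. -/
theorem integral_quadratic_mul_rpow {α : ℝ} (h0 : 0 < α) (h2 : α < 2) (a b c k l r : ℝ)
    (hlr : l ≤ r) (hk : 0 < k + l) :
    ∫ s in l..r, (a + b * s + c * s ^ 2) * (k + s) ^ (-1 - α) =
      ((a + b * r + c * r ^ 2) * (-((k + r) ^ (-α)) / α) - (b + 2 * c * r) * phiDeriv α (k + r)
        + 2 * c * phi α (k + r)) -
      ((a + b * l + c * l ^ 2) * (-((k + l) ^ (-α)) / α) - (b + 2 * c * l) * phiDeriv α (k + l)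
        + 2 * c * phi α (k + l)) := by
  have hpos : ∀ s ∈ Set.uIcc l r, 0 < k + s := fun s hs => by
    rw [Set.uIcc_of_le hlr] at hs; linarith [hs.1]
  refine intervalIntegral.integral_eq_sub_of_hasDerivAt (f := fun s =>
    (a + b * s + c * s ^ 2) * (-((k + s) ^ (-α)) / α) - (b + 2 * c * s) * phiDeriv α (k + s)
        + 2 * c * phi α (k + s)) (fun s hs => ?_) ?_
  · have hp := hpos s hs
    have e : HasDerivAt (fun s : ℝ => k + s) 1 s := (hasDerivAt_id s).const_add k
    have d0 := (hasDerivAt_phi h2 hp).comp s e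
    have d1 := (hasDerivAt_phiDeriv h0 hp).comp s e
    have d2 := (hasDerivAt_phiDeriv2 h0 hp).comp s e
    have q1 : HasDerivAt (fun s : ℝ => b + 2 * c * s) (2 * c) s := by
      simpa using ((hasDerivAt_id s).const_mul (2 * c)).const_add b
    have q0 : HasDerivAt (fun s : ℝ => a + b * s + c * s ^ 2) (b + 2 * c * s) s := by
      have := (((hasDerivAt_id s).const_mul b).const_add a).add
        (((hasDerivAt_id s).pow 2).const_mul c)
      refine this.congr_deriv ?_
      simp; ring
    refine (((q0.mul d2).sub (q1.mul d1)).add (d0.const_mul (2 * c))).congr_deriv ?_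
    simp only [Function.comp]
    ring
  · refine ContinuousOn.intervalIntegrable (ContinuousOn.mul (by fun_prop) ?_)
    exact continuousOn_rpow_comp (by fun_prop) hpos

/-- Integration by parts against a quadratic weight, to the left of `k`. -/
theorem integral_quadratic_mul_rpow_sub {α : ℝ} (h0 : 0 < α) (h2 : α < 2) (a b c k r : ℝ)
    (hr : 0 ≤ r) (hk : 0 < k - r) :
    ∫ s in (0 : ℝ)..r, (a + b * s + c * s ^ 2) * (k - s) ^ (-1 - α) =
      (a * (-(k ^ (-α)) / α) + b * phiDeriv α k + 2 * c * phi α k) -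
      ((a + b * r + c * r ^ 2) * (-((k - r) ^ (-α)) / α) + (b + 2 * c * r) * phiDeriv α (k - r)
        + 2 * c * phi α (k - r)) := by
  have := integral_quadratic_mul_rpow h0 h2 a (-b) c k (-r) 0 (by linarith) (by linarith)
  have e := intervalIntegral.integral_comp_neg (a := 0) (b := r)
    (fun s => (a + -b * s + c * s ^ 2) * (k + s) ^ (-1 - α))
  rw [neg_zero, this] at e
  rw [show (fun s : ℝ => (a + b * s + c * s ^ 2) * (k - s) ^ (-1 - α)) =
    fun s => (a + -b * -s + c * (-s) ^ 2) * (k + -s) ^ (-1 - α) by funext s; ring_nf, e]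
  simp only [add_zero, mul_zero, ← sub_eq_add_neg]
  ring

/-- The dimensionless Huang–Oberman weight at the positive integer `n`. -/
def hoWeight (α : ℝ) (n : ℕ) : ℝ :=
  if n = 1 then
      1 / (2 - α) - deriv (deriv (phi α)) 1 - (deriv (phi α) 3 + 3 * deriv (phi α) 1) / 2
        + phi α 3 - phi α 1
    else if Even n then
      2 * (deriv (phi α) ((n : ℝ) + 1) + deriv (phi α) ((n : ℝ) - 1) - phi α ((n : ℝ) + 1)
        + phi α ((n : ℝ) - 1))
    else
      -((deriv (phi α) ((n : ℝ) + 2) + 6 * deriv (phi α) (n : ℝ)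
        + deriv (phi α) ((n : ℝ) - 2)) / 2)
        + phi α ((n : ℝ) + 2) - phi α ((n : ℝ) - 2)

theorem beta_eq {α h : ℝ} {k : ℤ} (hk : k ≠ 0) :
    beta α h k = fracConst α / h ^ (1 + α) * hoWeight α k.natAbs := by
  have : k.natAbs ≠ 0 := by simpa using hk
  simp only [beta, hoWeight, if_neg this]

/-- The term 1 / (2 − α) is ∫₀¹ y² y^(−1−α) dy, the contribution of the singular cell. The integral
is the endpoint basis function of the panel [1, 3]. -/
theorem hoWeight_one {α : ℝ} (h0 : 0 < α) (h2 : α < 2) :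
    hoWeight α 1 = 1 / (2 - α) +
      ∫ s in (0 : ℝ)..2, (1 + (-3 / 2) * s + (1 / 2) * s ^ 2) * (1 + s) ^ (-1 - α) := by
  rw [integral_quadratic_mul_rpow h0 h2 _ _ _ 1 0 2 (by norm_num) (by norm_num), hoWeight,
    if_pos rfl, deriv_deriv_phi_one h0 h2, deriv_phi h2 one_pos, deriv_phi h2 three_pos]
  norm_num
  ring

/-- An even node is the midpoint of a single panel [n − 1, n + 1], whose Lagrange basis function 1 −
s² is nonnegative there. -/
theorem hoWeight_even {α : ℝ} (h0 : 0 < α) (h2 : α < 2) {n : ℕ} (hn : Even n) (hn2 : 2 ≤ n) :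
    hoWeight α n = ∫ s in (-1 : ℝ)..1, (1 + 0 * s + (-1) * s ^ 2) * (n + s) ^ (-1 - α) := by
  have hn' : (2 : ℝ) ≤ n := by exact_mod_cast hn2
  rw [integral_quadratic_mul_rpow h0 h2 _ _ _ n (-1) 1 (by norm_num) (by linarith), hoWeight,
    if_neg (by omega), if_pos hn, deriv_phi h2 (by linarith), deriv_phi h2 (by linarith)]
  rw [← sub_eq_add_neg]
  ring

/-- An odd node is the common endpoint of the panels [n − 2, n] and [n, n + 2], and each contributes
its endpoint basis function. -/
theorem hoWeight_odd {α : ℝ} (h0 : 0 < α) (h2 : α < 2) {n : ℕ} (hn : ¬ Even n) (hn3 : 3 ≤ n) :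
    hoWeight α n =
      (∫ s in (0 : ℝ)..2, (1 + (-3 / 2) * s + (1 / 2) * s ^ 2) * (n + s) ^ (-1 - α)) +
      ∫ s in (0 : ℝ)..2, (1 + (-3 / 2) * s + (1 / 2) * s ^ 2) * (n - s) ^ (-1 - α) := by
  have hn' : (3 : ℝ) ≤ n := by exact_mod_cast hn3
  rw [integral_quadratic_mul_rpow h0 h2 _ _ _ n 0 2 (by norm_num) (by linarith),
    integral_quadratic_mul_rpow_sub h0 h2 _ _ _ n 2 (by norm_num) (by linarith), hoWeight,
    if_neg (by omega), if_neg hn, deriv_phi h2 (by linarith), deriv_phi h2 (by linarith),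
    deriv_phi h2 (by linarith)]
  rw [add_zero]
  ring

/-! ### Integrals against the sign-changing endpoint basis function. -/

/-- The quadratic Lagrange basis function at the endpoint `0` of `[0, 2]`. -/
def endWeight (s : ℝ) : ℝ := 1 + (-3 / 2) * s + (1 / 2) * s ^ 2

theorem continuous_endWeight : Continuous endWeight := by unfold endWeight; fun_prop

theorem endWeight_nonneg {s : ℝ} (h : s ≤ 1) : 0 ≤ endWeight s := by
  unfold endWeight; nlinarith [mul_nonneg (sub_nonneg.2 h) (sub_nonneg.2 h)]

theorem endWeight_nonpos {s : ℝ} (h1 : 1 ≤ s) (h2 : s ≤ 2) : endWeight s ≤ 0 := by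
  unfold endWeight; nlinarith [mul_nonneg (sub_nonneg.2 h1) (sub_nonneg.2 h2)]

theorem endWeight_le_one {s : ℝ} (h1 : 0 ≤ s) (h2 : s ≤ 2) : endWeight s ≤ 1 := by
  unfold endWeight; nlinarith [mul_nonneg h1 (sub_nonneg.2 h2)]

/-- Comparison of integrals against the sign-changing weight `endWeight`. -/
theorem integral_endWeight_mono {u v : ℝ → ℝ} (hu : ContinuousOn u (Set.Icc 0 2))
    (hv : ContinuousOn v (Set.Icc 0 2)) (h1 : ∀ s, 0 ≤ s → s ≤ 1 → v s ≤ u s)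
    (h2 : ∀ s, 1 ≤ s → s ≤ 2 → u s ≤ v s) :
    ∫ s in (0 : ℝ)..2, endWeight s * v s ≤ ∫ s in (0 : ℝ)..2, endWeight s * u s := by
  have hI : ∀ {w : ℝ → ℝ}, ContinuousOn w (Set.Icc 0 2) →
      IntervalIntegrable (fun s => endWeight s * w s) volume 0 2 := fun hw => by
    refine ContinuousOn.intervalIntegrable ?_
    rw [Set.uIcc_of_le (by norm_num)]
    exact continuous_endWeight.continuousOn.mul hw
  refine intervalIntegral.integral_mono_on (by norm_num) (hI hv) (hI hu) fun s hs => ?_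
  rcases le_total s 1 with h | h
  · exact mul_le_mul_of_nonneg_left (h1 s hs.1 h) (endWeight_nonneg h)
  · exact mul_le_mul_of_nonpos_left (h2 s h hs.2) (endWeight_nonpos h hs.2)

theorem integral_endWeight : ∫ s in (0 : ℝ)..2, endWeight s = 1 / 3 := by
  unfold endWeight
  rw [intervalIntegral.integral_eq_sub_of_hasDerivAt
    (f := fun s => s - 3 / 4 * s ^ 2 + 1 / 6 * s ^ 3)]
  · norm_num
  · intro s _
    have := ((hasDerivAt_id s).sub (((hasDerivAt_id s).pow 2).const_mul (3 / 4))).add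
      (((hasDerivAt_id s).pow 3).const_mul (1 / 6))
    refine this.congr_deriv ?_
    simp; ring
  · exact (continuous_endWeight).intervalIntegrable _ _

theorem integral_endWeight_div :
    ∫ s in (0 : ℝ)..2, endWeight s * (3 + s)⁻¹ = 10 * (Real.log 5 - Real.log 3) - 5 := by
  rw [intervalIntegral.integral_eq_sub_of_hasDerivAt
    (f := fun s => 10 * Real.log (3 + s) - 9 / 2 * (3 + s) + (3 + s) ^ 2 / 4)]
  · norm_num; ring
  · intro s hs
    rw [Set.uIcc_of_le (by norm_num)] at hs
    have hp : (3 + s) ≠ 0 := by linarith [hs.1]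
    have e : HasDerivAt (fun s : ℝ => 3 + s) 1 s := (hasDerivAt_id s).const_add 3
    have := (((e.log hp).const_mul 10).sub (e.const_mul (9 / 2))).add ((e.pow 2).div_const 4)
    refine this.congr_deriv ?_
    unfold endWeight
    field_simp
    norm_num
    ring
  · refine ContinuousOn.intervalIntegrable ?_
    rw [Set.uIcc_of_le (by norm_num)]
    refine continuous_endWeight.continuousOn.mul (ContinuousOn.inv₀ (by fun_prop) ?_)
    intro s hs; linarith [hs.1]

/-- This is the worst left-panel integral, for n = 3 and exponent −3, normalised to have the
integrand factor 1 at s = 1. Its value is about −0.05, so left panels can be negative, but only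
slightly. -/
theorem integral_endWeight_cube :
    ∫ s in (0 : ℝ)..2, endWeight s * (8 / (3 - s) ^ 3) = 4 * Real.log 3 - 40 / 9 := by
  rw [intervalIntegral.integral_eq_sub_of_hasDerivAt
    (f := fun s => 4 * (-Real.log (3 - s) - 3 / (3 - s) + 1 / (3 - s) ^ 2))]
  · norm_num; ring
  · intro s hs
    rw [Set.uIcc_of_le (by norm_num)] at hs
    have hp : (3 - s) ≠ 0 := by linarith [hs.2]
    have e : HasDerivAt (fun s : ℝ => 3 - s) (-1) s := (hasDerivAt_id s).const_sub 3
    have := (((e.log hp).neg.sub ((hasDerivAt_const s (3 : ℝ)).div e hp)).add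
      ((hasDerivAt_const s (1 : ℝ)).div (e.pow 2) (pow_ne_zero 2 hp))).const_mul 4
    refine this.congr_deriv ?_
    simp only [endWeight, Pi.pow_apply]
    field_simp
    ring
  · refine ContinuousOn.intervalIntegrable ?_
    rw [Set.uIcc_of_le (by norm_num)]
    refine continuous_endWeight.continuousOn.mul (ContinuousOn.div (by fun_prop) (by fun_prop) ?_)
    intro s hs; exact pow_ne_zero 3 (by linarith [hs.2])

theorem continuousOn_add_rpow {k e : ℝ} (hk : 0 < k) :
    ContinuousOn (fun s => (k + s) ^ e) (Set.Icc 0 2) :=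
  continuousOn_rpow_comp (by fun_prop) fun s hs => by linarith [hs.1]

theorem continuousOn_sub_rpow {k e : ℝ} (hk : 2 < k) :
    ContinuousOn (fun s => (k - s) ^ e) (Set.Icc 0 2) :=
  continuousOn_rpow_comp (by fun_prop) fun s hs => by linarith [hs.2]

/-- The power is decreasing in s and `endWeight` changes sign from plus to minus at s = 1, so
freezing the power at s = 1 can only lower the integral. -/
theorem integral_endWeight_add_ge {e k : ℝ} (he : e ≤ 0) (hk : 0 < k) :
    (k + 1) ^ e / 3 ≤ ∫ s in (0 : ℝ)..2, endWeight s * (k + s) ^ e := by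
  have := integral_endWeight_mono (u := fun s => (k + s) ^ e) (v := fun _ => (k + 1) ^ e)
    (continuousOn_add_rpow hk) continuousOn_const
    (fun s h0 h1 => Real.rpow_le_rpow_of_nonpos (by linarith) (by linarith) he)
    (fun s h0 h1 => Real.rpow_le_rpow_of_nonpos (by linarith) (by linarith) he)
  rw [intervalIntegral.integral_mul_const, integral_endWeight] at this
  linarith

/-- The constant 1/3 obtained by freezing the whole power is too small for the weight at 3. Here a
factor (3 + s)⁻¹ is kept and integrated exactly, and only the power e + 1 ≤ 0 is frozen at s = 1.
The constant improves to about 0.433. -/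
theorem integral_endWeight_three_add_ge {e : ℝ} (he : e ≤ -1) :
    (4 : ℝ) ^ e * (4 * (10 * (Real.log 5 - Real.log 3) - 5)) ≤
      ∫ s in (0 : ℝ)..2, endWeight s * (3 + s) ^ e := by
  have key : ∀ s : ℝ, 0 ≤ s → (3 + s) ^ e = (3 + s) ^ (e + 1) * (3 + s)⁻¹ := fun s hs => by
    rw [Real.rpow_add_one (by linarith), mul_assoc, mul_inv_cancel₀ (by linarith), mul_one]
  have e4 : (4 : ℝ) ^ e * 4 = 4 ^ (e + 1) := (Real.rpow_add_one (by norm_num) e).symm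
  have e5 : (3 : ℝ) + 1 = 4 := by norm_num
  have := integral_endWeight_mono (u := fun s => (3 + s) ^ e)
    (v := fun s => (3 + s)⁻¹ * 4 ^ (e + 1))
    (continuousOn_add_rpow (by norm_num))
    (ContinuousOn.mul (ContinuousOn.inv₀ (by fun_prop) (fun s hs => by linarith [hs.1]))
      continuousOn_const)
    (fun s h0 h1 => by
      simp only [key s h0]
      rw [mul_comm]
      refine mul_le_mul_of_nonneg_right ?_ (inv_nonneg.2 (by linarith))
      exact Real.rpow_le_rpow_of_nonpos (by linarith) (by linarith) (by linarith))
    (fun s h0 h1 => by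
      simp only [key s (by linarith)]
      rw [mul_comm (3 + s)⁻¹]
      refine mul_le_mul_of_nonneg_right ?_ (inv_nonneg.2 (by linarith))
      exact Real.rpow_le_rpow_of_nonpos (by linarith) (by linarith) (by linarith))
  simp only [← mul_assoc, intervalIntegral.integral_mul_const, integral_endWeight_div, ← e4]
    at this
  linarith

/-- Here the power increases in s, so freezing goes the wrong way. Normalised at s = 1, the ratio (k
− s)/(k − 1) stays between 1 and (3 − s)/2 on both sides of s = 1, so the extreme case is k = 3, e =
−3. -/
theorem integral_endWeight_sub_ge {e k : ℝ} (he3 : -3 ≤ e) (hk : 3 ≤ k) :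
    (k - 1) ^ e * (4 * Real.log 3 - 40 / 9) ≤
      ∫ s in (0 : ℝ)..2, endWeight s * (k - s) ^ e := by
  have hk1 : 0 < k - 1 := by linarith
  have key : ∀ s : ℝ, s ≤ 2 → (k - s) ^ e = (k - 1) ^ e * ((k - s) / (k - 1)) ^ e :=
    fun s hs => by
      rw [← Real.mul_rpow (by linarith) (div_nonneg (by linarith) hk1.le),
        mul_div_cancel₀ _ hk1.ne']
  have cube : ∀ s : ℝ, s ≤ 2 → 8 / (3 - s) ^ 3 = ((3 - s) / 2) ^ (-3 : ℝ) := fun s hs => by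
    have h3 : (0 : ℝ) < 3 - s := by linarith
    rw [Real.rpow_neg (by positivity), show (3 : ℝ) = ((3 : ℕ) : ℝ) by norm_num,
      Real.rpow_natCast]
    push_cast
    rw [div_pow, inv_div]
    norm_num
  have := integral_endWeight_mono (u := fun s => (k - s) ^ e)
    (v := fun s => 8 / (3 - s) ^ 3 * (k - 1) ^ e)
    (continuousOn_sub_rpow (by linarith))
    (ContinuousOn.mul (ContinuousOn.div (by fun_prop) (by fun_prop)
      (fun s hs => pow_ne_zero 3 (by linarith [hs.2]))) continuousOn_const)
    (fun s h0 h1 => by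
      simp only [key s (by linarith), mul_comm]
      refine mul_le_mul_of_nonneg_left ?_ (by positivity)
      rw [cube s (by linarith)]
      have hb : 1 ≤ (k - s) / (k - 1) := by rw [le_div_iff₀ hk1]; linarith
      refine (Real.rpow_le_rpow_of_nonpos (by linarith) (?_ : _ ≤ (3 - s) / 2)
        (by norm_num)).trans (Real.rpow_le_rpow_of_exponent_le hb he3)
      rw [div_le_iff₀ hk1]
      nlinarith [mul_nonneg (sub_nonneg.2 h1) (sub_nonneg.2 hk)])
    (fun s h0 h1 => by
      simp only [key s (by linarith), mul_comm]
      refine mul_le_mul_of_nonneg_left ?_ (by positivity)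
      rw [cube s (by linarith)]
      have hb : (k - s) / (k - 1) ≤ 1 := by rw [div_le_iff₀ hk1]; linarith
      refine (Real.rpow_le_rpow_of_exponent_ge (div_pos (by linarith) hk1) hb he3).trans
        (Real.rpow_le_rpow_of_nonpos (by linarith) ?_ (by norm_num))
      rw [le_div_iff₀ hk1]
      nlinarith [mul_nonneg (sub_nonneg.2 h0) (sub_nonneg.2 hk)])
  simp only [← mul_assoc, intervalIntegral.integral_mul_const, integral_endWeight_cube] at this
  linarith

theorem integral_endWeight_le {u : ℝ → ℝ} {C : ℝ} (hu : ContinuousOn u (Set.Icc 0 2))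
    (h0 : ∀ s, 0 ≤ s → s ≤ 2 → 0 ≤ u s) (hC : ∀ s, 0 ≤ s → s ≤ 2 → u s ≤ C) :
    ∫ s in (0 : ℝ)..2, endWeight s * u s ≤ 2 * C := by
  have : ∫ s in (0 : ℝ)..2, endWeight s * u s ≤ ∫ s in (0 : ℝ)..2, C := by
    refine intervalIntegral.integral_mono_on (by norm_num) ?_ (by simp) fun s hs => ?_
    · refine ContinuousOn.intervalIntegrable ?_
      rw [Set.uIcc_of_le (by norm_num)]
      exact continuous_endWeight.continuousOn.mul hu
    · nlinarith [endWeight_le_one hs.1 hs.2, h0 s hs.1 hs.2, hC s hs.1 hs.2]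
  simpa using this

/-! ### Positivity and size of the weights. -/

section

variable {α : ℝ}

theorem hoWeight_one_pos (h0 : 0 < α) (h2 : α < 2) : 0 < hoWeight α 1 := by
  rw [hoWeight_one h0 h2]
  have := integral_endWeight_add_ge (e := -1 - α) (k := 1) (by linarith) one_pos
  have h3 : (0 : ℝ) < 1 / (2 - α) := by apply one_div_pos.2; linarith
  have h4 : (0 : ℝ) < ((1 : ℝ) + 1) ^ (-1 - α) / 3 := by positivity
  unfold endWeight at this
  linarith

theorem hoWeight_three_pos (h0 : 0 < α) (h2 : α < 2) : 0 < hoWeight α 3 := by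
  rw [hoWeight_odd h0 h2 (by decide) le_rfl]
  have a1 := integral_endWeight_three_add_ge (e := -1 - α) (by linarith)
  have a2 := integral_endWeight_sub_ge (e := -1 - α) (k := 3) (by linarith) le_rfl
  have h4 : (0 : ℝ) < (4 : ℝ) ^ (-1 - α) := by positivity
  -- Since 4^e = 2^e · 2^e, this is 2^e ≥ 1/8, which holds because e = −1 − α > −3.
  have h5 : (3 - 1 : ℝ) ^ (-1 - α) ≤ (4 : ℝ) ^ (-1 - α) * 8 := by
    have : (4 : ℝ) ^ (-1 - α) = 2 ^ (-1 - α) * 2 ^ (-1 - α) := by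
      rw [← Real.mul_rpow (by norm_num) (by norm_num)]; norm_num
    rw [this, mul_assoc, show (3 - 1 : ℝ) = 2 by norm_num]
    have h6 : (1 / 8 : ℝ) ≤ 2 ^ (-1 - α) := by
      have := Real.rpow_le_rpow_of_exponent_le (x := 2) (y := -3) (z := -1 - α) (by norm_num)
        (by linarith)
      refine le_trans ?_ this
      rw [Real.rpow_neg (by norm_num), show (3 : ℝ) = ((3 : ℕ) : ℝ) by norm_num,
        Real.rpow_natCast]
      norm_num
    have h7 : (0 : ℝ) < 2 ^ (-1 - α) := by positivity
    nlinarith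
  have l3 := Real.log_three_gt_d9
  have l3' := Real.log_three_lt_d9
  have l5 := Real.log_five_gt_d9
  unfold endWeight at a1 a2
  push_cast
  -- The right panel gains 0.43 and the left one loses at most 8 · 0.0501 = 0.4008, both in units of
  -- 4^(−1−α). The margin is narrow, hence the accurate logarithms.
  have b1 : (4 : ℝ) ^ (-1 - α) * 0.43 ≤
      (4 : ℝ) ^ (-1 - α) * (4 * (10 * (Real.log 5 - Real.log 3) - 5)) :=
    mul_le_mul_of_nonneg_left (by linarith) h4.le
  have b2 : (4 : ℝ) ^ (-1 - α) * 8 * (-0.0501) ≤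
      (3 - 1 : ℝ) ^ (-1 - α) * (4 * Real.log 3 - 40 / 9) := by
    have h8 : (0 : ℝ) < (3 - 1 : ℝ) ^ (-1 - α) := by norm_num; positivity
    have := mul_le_mul_of_nonneg_left (by linarith : -0.0501 ≤ 4 * Real.log 3 - 40 / 9) h8.le
    exact (mul_le_mul_of_nonpos_right h5 (by norm_num)).trans this
  exact lt_of_lt_of_le (by linarith) (add_le_add (b1.trans a1) (b2.trans a2))

theorem hoWeight_odd_ge (h0 : 0 < α) (h2 : α < 2) {n : ℕ} (hn : ¬ Even n) (hn5 : 5 ≤ n) :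
    1 / 10 * ((n : ℝ) + 1) ^ (-1 - α) ≤ hoWeight α n := by
  have hn' : (5 : ℝ) ≤ n := by exact_mod_cast hn5
  rw [hoWeight_odd h0 h2 hn (by omega)]
  have a1 := integral_endWeight_add_ge (e := -1 - α) (k := n) (by linarith) (by linarith)
  have a2 := integral_endWeight_sub_ge (e := -1 - α) (k := n) (by linarith)
    (by linarith)
  have h4 : (0 : ℝ) < ((n : ℝ) + 1) ^ (-1 - α) := by positivity
  -- For n ≥ 5 the ratio (n − 1)/(n + 1) is at least 2/3, and (2/3)^(−3) = 27/8. The panels then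
  -- leave 1/3 − 0.06 · 27/8 > 1/10.
  have h5 : ((n : ℝ) - 1) ^ (-1 - α) ≤ ((n : ℝ) + 1) ^ (-1 - α) * (27 / 8) := by
    have e : (n : ℝ) - 1 = ((n : ℝ) + 1) * (((n : ℝ) - 1) / (n + 1)) := by
      field_simp
    have hp : 0 ≤ ((n : ℝ) - 1) / (n + 1) := div_nonneg (by linarith) (by linarith)
    rw [e, Real.mul_rpow (by linarith) hp]
    refine mul_le_mul_of_nonneg_left ?_ h4.le
    have hr : (2 / 3 : ℝ) ≤ ((n : ℝ) - 1) / (n + 1) := by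
      rw [le_div_iff₀ (by linarith)]; linarith
    refine (Real.rpow_le_rpow_of_nonpos (by norm_num) hr (by linarith)).trans ?_
    refine (Real.rpow_le_rpow_of_exponent_ge (by norm_num) (by norm_num)
      (by linarith : (-3 : ℝ) ≤ -1 - α)).trans ?_
    rw [Real.rpow_neg (by norm_num), show (3 : ℝ) = ((3 : ℕ) : ℝ) by norm_num,
      Real.rpow_natCast]
    norm_num
  have l3 := Real.log_three_gt_d9
  unfold endWeight at a1 a2
  have h8 : 0 ≤ ((n : ℝ) - 1) ^ (-1 - α) := Real.rpow_nonneg (by linarith) _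
  have := mul_le_mul_of_nonneg_left (by linarith : -0.06 ≤ 4 * Real.log 3 - 40 / 9) h8
  linarith

theorem hoWeight_odd_le (h0 : 0 < α) (h2 : α < 2) {n : ℕ} (hn : ¬ Even n) (hn3 : 3 ≤ n) :
    hoWeight α n ≤ 4 * ((n : ℝ) - 2) ^ (-1 - α) := by
  have hn' : (3 : ℝ) ≤ n := by exact_mod_cast hn3
  rw [hoWeight_odd h0 h2 hn hn3]
  have a1 := integral_endWeight_le (C := ((n : ℝ) - 2) ^ (-1 - α))
    (continuousOn_add_rpow (k := n) (e := -1 - α) (by linarith))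
    (fun s _ _ => Real.rpow_nonneg (by linarith) _)
    (fun s _ _ => Real.rpow_le_rpow_of_nonpos (by linarith) (by linarith) (by linarith))
  have a2 := integral_endWeight_le (C := ((n : ℝ) - 2) ^ (-1 - α))
    (continuousOn_sub_rpow (k := n) (e := -1 - α) (by linarith))
    (fun s _ _ => Real.rpow_nonneg (by linarith) _)
    (fun s _ _ => Real.rpow_le_rpow_of_nonpos (by linarith) (by linarith) (by linarith))
  unfold endWeight at a1 a2
  linarith

theorem hoWeight_even_bounds (h0 : 0 < α) (h2 : α < 2) {n : ℕ} (hn : Even n) (hn2 : 2 ≤ n) :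
    1 / 10 * ((n : ℝ) + 1) ^ (-1 - α) ≤ hoWeight α n ∧
      hoWeight α n ≤ 4 * ((n : ℝ) - 1) ^ (-1 - α) := by
  have hn' : (2 : ℝ) ≤ n := by exact_mod_cast hn2
  rw [hoWeight_even h0 h2 hn hn2]
  have hc : IntervalIntegrable (fun s : ℝ => (1 + 0 * s + (-1) * s ^ 2) * ((n : ℝ) + s) ^ (-1 - α))
      volume (-1) 1 := by
    refine ContinuousOn.intervalIntegrable (ContinuousOn.mul (by fun_prop) ?_)
    rw [Set.uIcc_of_le (by norm_num)]
    exact continuousOn_rpow_comp (by fun_prop) fun s hs => by linarith [hs.1]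
  have hc' : ∀ C : ℝ, IntervalIntegrable (fun s : ℝ => (1 + 0 * s + (-1) * s ^ 2) * C)
      volume (-1) 1 := fun C => (by fun_prop : Continuous _).intervalIntegrable _ _
  have hv : ∀ C : ℝ, ∫ s in (-1 : ℝ)..1, (1 + 0 * s + (-1) * s ^ 2) * C = 4 / 3 * C := fun C => by
    rw [intervalIntegral.integral_mul_const]
    congr 1
    rw [intervalIntegral.integral_eq_sub_of_hasDerivAt (f := fun s => s - 1 / 3 * s ^ 3)]
    · norm_num
    · intro s _
      refine ((hasDerivAt_id s).sub (((hasDerivAt_id s).pow 3).const_mul (1 / 3))).congr_deriv ?_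
      simp; ring
    · exact (by fun_prop : Continuous _).intervalIntegrable _ _
  have hq : ∀ s ∈ Set.Icc (-1 : ℝ) 1, (0 : ℝ) ≤ 1 + 0 * s + (-1) * s ^ 2 := fun s hs => by
    nlinarith [mul_nonneg (neg_le_iff_add_nonneg'.1 hs.1) (sub_nonneg.2 hs.2)]
  have a1 := intervalIntegral.integral_mono_on (by norm_num) (hc' (((n : ℝ) + 1) ^ (-1 - α))) hc
    fun s hs => mul_le_mul_of_nonneg_left (Real.rpow_le_rpow_of_nonpos (by linarith [hs.1])
      (by linarith [hs.2]) (by linarith)) (hq s hs)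
  have a2 := intervalIntegral.integral_mono_on (by norm_num) hc (hc' (((n : ℝ) - 1) ^ (-1 - α)))
    fun s hs => mul_le_mul_of_nonneg_left (Real.rpow_le_rpow_of_nonpos (by linarith)
      (by linarith [hs.1]) (by linarith)) (hq s hs)
  rw [hv] at a1 a2
  have p1 : 0 ≤ ((n : ℝ) + 1) ^ (-1 - α) := by positivity
  have p2 : 0 ≤ ((n : ℝ) - 1) ^ (-1 - α) := Real.rpow_nonneg (by linarith) _
  constructor <;> linarith

/-- The Huang–Oberman weights are positive and comparable to `n ^ (-1 - α)`. -/
theorem hoWeight_bounds (h0 : 0 < α) (h2 : α < 2) :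
    ∃ c C : ℝ, 0 < c ∧ ∀ n : ℕ, 1 ≤ n →
      c * (n : ℝ) ^ (-1 - α) ≤ hoWeight α n ∧ hoWeight α n ≤ C * (n : ℝ) ^ (-1 - α) := by
  have p1 := hoWeight_one_pos h0 h2
  have p3 := hoWeight_three_pos h0 h2
  have pe : (0 : ℝ) < 1 / 10 * 2 ^ (-1 - α) := by positivity
  -- The indices 1 and 3 enter through their own values; all others use n + 1 ≤ 2n below. For n ≠ 1
  -- the upper bound uses that n − 1 (even) and n − 2 (odd) are at least n/3.
  refine ⟨min (hoWeight α 1) (min (hoWeight α 3) (1 / 10 * 2 ^ (-1 - α))),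
    max (hoWeight α 1) (4 * (1 / 3) ^ (-1 - α)), lt_min p1 (lt_min p3 pe), fun n hn => ?_⟩
  have hn' : (1 : ℝ) ≤ n := by exact_mod_cast hn
  have hpn : (0 : ℝ) < (n : ℝ) ^ (-1 - α) := by positivity
  have hle1 : (n : ℝ) ^ (-1 - α) ≤ 1 := Real.rpow_le_one_of_one_le_of_nonpos hn' (by linarith)
  have low : ∀ {x : ℝ}, 0 < x → min (hoWeight α 1) (min (hoWeight α 3) (1 / 10 * 2 ^ (-1 - α))) ≤ x
      → min (hoWeight α 1) (min (hoWeight α 3) (1 / 10 * 2 ^ (-1 - α))) * (n : ℝ) ^ (-1 - α) ≤ x :=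
    fun hx h => by nlinarith [lt_min p1 (lt_min p3 pe)]
  have gen : 1 / 10 * ((n : ℝ) + 1) ^ (-1 - α) ≤ hoWeight α n →
      min (hoWeight α 1) (min (hoWeight α 3) (1 / 10 * 2 ^ (-1 - α))) * (n : ℝ) ^ (-1 - α)
        ≤ hoWeight α n := fun h => by
    refine le_trans ?_ h
    have : (2 : ℝ) ^ (-1 - α) * (n : ℝ) ^ (-1 - α) ≤ ((n : ℝ) + 1) ^ (-1 - α) := by
      rw [← Real.mul_rpow (by norm_num) (by linarith)]
      exact Real.rpow_le_rpow_of_nonpos (by linarith) (by linarith) (by linarith)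
    have h3 : min (hoWeight α 1) (min (hoWeight α 3) (1 / 10 * 2 ^ (-1 - α)))
      ≤ 1 / 10 * 2 ^ (-1 - α) := (min_le_right _ _).trans (min_le_right _ _)
    nlinarith
  have up : ∀ m : ℝ, 1 / 3 * n ≤ m → hoWeight α n ≤ 4 * m ^ (-1 - α) →
      hoWeight α n ≤ max (hoWeight α 1) (4 * (1 / 3) ^ (-1 - α)) * (n : ℝ) ^ (-1 - α) :=
    fun m hm h => by
      refine h.trans ?_
      have : m ^ (-1 - α) ≤ (1 / 3) ^ (-1 - α) * (n : ℝ) ^ (-1 - α) := by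
        rw [← Real.mul_rpow (by norm_num) (by linarith)]
        exact Real.rpow_le_rpow_of_nonpos (by linarith) hm (by linarith)
      have h3 := le_max_right (hoWeight α 1) (4 * (1 / 3) ^ (-1 - α))
      nlinarith
  by_cases n1 : n = 1
  · subst n1
    simp
  by_cases he : Even n
  · have n2 : (2 : ℝ) ≤ n := by exact_mod_cast (by omega : 2 ≤ n)
    have := hoWeight_even_bounds h0 h2 he (by omega)
    exact ⟨gen this.1, up _ (by linarith) this.2⟩
  · have hn3 : 3 ≤ n := by
      rcases Nat.lt_or_ge n 3 with h | h
      · have : n = 2 := by omega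
        subst this; exact absurd (by decide) he
      · exact h
    have n3 : (3 : ℝ) ≤ n := by exact_mod_cast hn3
    refine ⟨?_, up _ (by linarith) (hoWeight_odd_le h0 h2 he hn3)⟩
    rcases Nat.lt_or_ge n 5 with h | h
    · have : n = 3 := by
        rcases (by omega : n = 3 ∨ n = 4) with h | h
        · exact h
        · subst h; exact absurd (by decide) he
      subst this
      exact low p3 ((min_le_right _ _).trans (min_le_left _ _))
    · exact gen (hoWeight_odd_ge h0 h2 he h)

theorem fracConst_pos (h0 : 0 < α) (h2 : α < 2) : 0 < fracConst α := by
  unfold fracConst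
  -- The argument lies in (−1, 0), strictly between two poles.
  have h1 : Real.Gamma (-(α / 2)) ≠ 0 := by
    refine Real.Gamma_ne_zero fun m hm => ?_
    have hm1 : (m : ℝ) = α / 2 := by linarith
    have hm0 : (m : ℝ) < 1 := by linarith
    have hm2 : m = 0 := by
      have : m < 1 := by exact_mod_cast hm0
      omega
    rw [hm2] at hm1
    simp at hm1
    linarith
  have h3 := Real.Gamma_pos_of_pos (by linarith : 0 < (α + 1) / 2)
  have h4 := Real.sqrt_pos.2 Real.pi_pos
  have h5 := abs_pos.2 h1
  positivity

/-- The weights `β_k^h` are even, nonnegative and comparable to `(|k| h) ^ (-1 - α)`. -/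
theorem beta_bounds (h0 : 0 < α) (h2 : α < 2) :
    ∃ c C : ℝ, 0 < c ∧ ∀ h : ℝ, 0 < h → ∀ k : ℤ, k ≠ 0 →
      c * (|(k : ℝ)| * h) ^ (-1 - α) ≤ beta α h k ∧
        beta α h k ≤ C * (|(k : ℝ)| * h) ^ (-1 - α) := by
  obtain ⟨c, C, hc, H⟩ := hoWeight_bounds h0 h2
  have hF := fracConst_pos h0 h2
  refine ⟨fracConst α * c, fracConst α * C, mul_pos hF hc, fun h hh k hk => ?_⟩
  have hn : 1 ≤ k.natAbs := Nat.one_le_iff_ne_zero.2 (by simpa using hk)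
  have e1 : (k.natAbs : ℝ) = |(k : ℝ)| := by rw [Nat.cast_natAbs]; simp
  have e2 : fracConst α / h ^ (1 + α) = fracConst α * h ^ (-1 - α) := by
    rw [show -1 - α = -(1 + α) by ring, Real.rpow_neg hh.le, div_eq_mul_inv]
  have := H _ hn
  rw [beta_eq hk, e2, Real.mul_rpow (abs_nonneg _) hh.le, ← e1]
  have hp : 0 < fracConst α * h ^ (-1 - α) := by positivity
  constructor <;> nlinarith [this.1, this.2]

theorem beta_zero (h : ℝ) : beta α h 0 = 0 := by simp [beta]

theorem beta_neg (h : ℝ) (k : ℤ) : beta α h (-k) = beta α h k := by simp [beta]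

end

/-! ### Cosine transforms and the compound Poisson series. -/

/-- The cosine transform `v ↦ ∫ cos (v ξ) m ξ dξ`. -/
def cosT (m : ℝ → ℝ) (v : ℝ) : ℝ := ∫ ξ, Real.cos (v * ξ) * m ξ

theorem integrable_cos_mul {m : ℝ → ℝ} (hm : Integrable m) (v : ℝ) :
    Integrable fun ξ => Real.cos (v * ξ) * m ξ :=
  hm.bdd_mul (c := 1) (by fun_prop) (ae_of_all _ fun ξ => Real.abs_cos_le_one _)

theorem abs_cosT_le {m : ℝ → ℝ} (hm : Integrable m) (v : ℝ) : |cosT m v| ≤ ∫ ξ, |m ξ| := by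
  refine (abs_integral_le_integral_abs).trans
    (integral_mono (integrable_cos_mul hm v).abs hm.abs fun ξ => ?_)
  simp only [abs_mul]
  exact mul_le_of_le_one_left (abs_nonneg _) (Real.abs_cos_le_one _)

theorem continuous_cosT {m : ℝ → ℝ} (hm : Integrable m) : Continuous (cosT m) := by
  refine continuous_of_dominated (bound := fun ξ => |m ξ|)
    (fun v => (integrable_cos_mul hm v).aestronglyMeasurable) (fun v => ae_of_all _ fun ξ => ?_)
    hm.abs (ae_of_all _ fun ξ => by fun_prop)
  rw [Real.norm_eq_abs, abs_mul]
  exact mul_le_of_le_one_left (abs_nonneg _) (Real.abs_cos_le_one _)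

theorem integral_sin_mul_eq_zero {p : ℝ → ℝ} (hp : ∀ y, p (-y) = p y) (ξ : ℝ) :
    ∫ y, Real.sin (ξ * y) * p y = 0 := by
  have := integral_neg_eq_self (μ := volume) (fun y => Real.sin (ξ * y) * p y)
  simp only [hp, mul_neg, Real.sin_neg, neg_mul, integral_neg] at this
  linarith

theorem integrable_mul_cosT {m p : ℝ → ℝ} (hm : Integrable m) (hp : Integrable p) :
    Integrable fun ξ => m ξ * cosT p ξ := by
  refine (hm.bdd_mul (c := ∫ y, |p y|) (continuous_cosT hp).aestronglyMeasurable
    (ae_of_all _ fun ξ => ?_)).congr (ae_of_all _ fun ξ => mul_comm _ _)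
  exact abs_cosT_le hp ξ

/-- The cosine transform of a product with the cosine transform of an even function is a
convolution. -/
theorem cosT_mul_cosT {m p : ℝ → ℝ} (hm : Integrable m) (hp : Integrable p)
    (he : ∀ y, p (-y) = p y) (v : ℝ) :
    cosT (fun ξ => m ξ * cosT p ξ) v = ∫ y, p y * cosT m (v - y) := by
  have h1 : ∀ ξ, Real.cos (v * ξ) * (m ξ * cosT p ξ) =
      ∫ y, p y * (Real.cos ((v - y) * ξ) * m ξ) := fun ξ => by
    have hs : Integrable fun y => Real.sin (ξ * y) * p y :=
      hp.bdd_mul (c := 1) (by fun_prop) (ae_of_all _ fun ξ => Real.abs_sin_le_one _)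
    have e : (fun y => p y * (Real.cos ((v - y) * ξ) * m ξ)) = fun y =>
        Real.cos (v * ξ) * m ξ * (Real.cos (ξ * y) * p y) +
          Real.sin (v * ξ) * m ξ * (Real.sin (ξ * y) * p y) := by
      funext y
      rw [sub_mul, Real.cos_sub, mul_comm y ξ]
      ring
    rw [e, integral_add ((integrable_cos_mul hp ξ).const_mul _) (hs.const_mul _),
      integral_const_mul, integral_const_mul, integral_sin_mul_eq_zero he, cosT]
    ring
  have h2 : ∀ y, p y * cosT m (v - y) = ∫ ξ, p y * (Real.cos ((v - y) * ξ) * m ξ) := fun y => by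
    rw [integral_const_mul, cosT]
  rw [cosT]
  simp only [h1, h2]
  rw [integral_integral_swap]
  have hpr : Integrable (fun z : ℝ × ℝ => m z.1 * p z.2) (volume.prod volume) := hm.mul_prod hp
  refine (hpr.bdd_mul (c := 1) (f := fun z : ℝ × ℝ => Real.cos ((v - z.2) * z.1)) (by fun_prop)
    (ae_of_all _ fun ξ => Real.abs_cos_le_one _)).congr (ae_of_all _ fun z => ?_)
  simp only [Function.uncurry]
  ring

theorem cosT_mul_pow_succ {m p : ℝ → ℝ} (hm : Integrable m) (hp : Integrable p)
    (he : ∀ y, p (-y) = p y) (n : ℕ) :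
    Integrable (fun ξ => m ξ * cosT p ξ ^ n) ∧
    ∀ v, cosT (fun ξ => m ξ * cosT p ξ ^ (n + 1)) v =
      ∫ y, p y * cosT (fun ξ => m ξ * cosT p ξ ^ n) (v - y) := by
  have hI : Integrable (fun ξ => m ξ * cosT p ξ ^ n) := by
    induction n with
    | zero => simpa using hm
    | succ n ih =>
      refine (integrable_mul_cosT ih hp).congr (ae_of_all _ fun ξ => ?_)
      simp only [pow_succ, mul_assoc]
  refine ⟨hI, fun v => ?_⟩
  rw [← cosT_mul_cosT hI hp he]
  simp only [pow_succ, mul_assoc]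

/-- Expanding the exponential and integrating term by term is legitimate because `cosT p` is bounded
by the L¹ norm B of p, so the n-th term is dominated by |m| Bⁿ / n!. By `cosT_mul_pow_succ` the n-th
term is an n-fold convolution: the case of exactly n jumps. -/
theorem hasSum_cosT_mul_exp {m p : ℝ → ℝ} (hm : Integrable m) (hp : Integrable p)
    (he : ∀ y, p (-y) = p y) (v : ℝ) :
    HasSum (fun n : ℕ => cosT (fun ξ => m ξ * cosT p ξ ^ n) v / n.factorial)
      (cosT (fun ξ => m ξ * Real.exp (cosT p ξ)) v) := by
  set B := ∫ y, |p y| with hB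
  have hB0 : 0 ≤ B := integral_nonneg fun _ => abs_nonneg _
  have hexp : ∀ x : ℝ, HasSum (fun n : ℕ => x ^ n / n.factorial) (Real.exp x) := fun x => by
    rw [Real.exp_eq_exp_ℝ]
    exact NormedSpace.expSeries_div_hasSum_exp x
  have hF : ∀ n : ℕ, Integrable
      fun ξ => Real.cos (v * ξ) * (m ξ * cosT p ξ ^ n) / n.factorial := fun n =>
    (integrable_cos_mul (cosT_mul_pow_succ hm hp he n).1 v).div_const _
  have hbd : ∀ (n : ℕ) ξ, ‖Real.cos (v * ξ) * (m ξ * cosT p ξ ^ n) / n.factorial‖ ≤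
      |m ξ| * (B ^ n / n.factorial) := fun n ξ => by
    rw [norm_div, Real.norm_natCast, mul_div_assoc']
    refine div_le_div_of_nonneg_right ?_ (Nat.cast_nonneg _)
    rw [Real.norm_eq_abs, abs_mul, abs_mul, abs_pow]
    exact (mul_le_of_le_one_left (by positivity) (Real.abs_cos_le_one _)).trans
      (mul_le_mul_of_nonneg_left (pow_le_pow_left₀ (abs_nonneg _) (abs_cosT_le hp ξ) _)
        (abs_nonneg _))
  have hs : Summable fun n : ℕ =>
      ∫ ξ, ‖Real.cos (v * ξ) * (m ξ * cosT p ξ ^ n) / n.factorial‖ := by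
    refine Summable.of_nonneg_of_le (fun n => integral_nonneg fun _ => norm_nonneg _)
      (fun n => (integral_mono (hF n).norm (hm.abs.mul_const _) (hbd n)).trans_eq
        (integral_mul_const _ _)) ((hexp B).summable.mul_left _)
  have := hasSum_integral_of_summable_integral_norm hF hs
  simp only [integral_div] at this
  have e : ∀ ξ, ∑' n : ℕ, Real.cos (v * ξ) * (m ξ * cosT p ξ ^ n) / n.factorial =
      Real.cos (v * ξ) * (m ξ * Real.exp (cosT p ξ)) := fun ξ => by
    rw [← (hexp (cosT p ξ)).tsum_eq, ← tsum_mul_left, ← tsum_mul_left]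
    refine tsum_congr fun n => ?_
    ring
  simp only [e] at this
  exact this

/-! ### The tail weight, its convolutions, and compound Poisson tails. -/

/-- The weight `max 1 |v| ^ (-1 - α)`, comparable to the stable density. -/
def tailWeight (α v : ℝ) : ℝ := max 1 |v| ^ (-1 - α)

theorem tailWeight_pos (α v : ℝ) : 0 < tailWeight α v := by unfold tailWeight; positivity

theorem tailWeight_neg (α v : ℝ) : tailWeight α (-v) = tailWeight α v := by
  simp [tailWeight]

theorem continuous_tailWeight (α : ℝ) : Continuous (tailWeight α) := by
  unfold tailWeight
  refine Continuous.rpow_const (by fun_prop) fun v => Or.inl ?_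
  positivity

theorem tailWeight_le_one {α : ℝ} (h0 : 0 < α) (v : ℝ) : tailWeight α v ≤ 1 :=
  Real.rpow_le_one_of_one_le_of_nonpos (le_max_left _ _) (by linarith)

theorem tailWeight_le_of_max_le {α : ℝ} (h0 : 0 < α) {K u v : ℝ} (hK : 0 < K)
    (h : max 1 |v| ≤ K * max 1 |u|) : tailWeight α u ≤ K ^ (1 + α) * tailWeight α v := by
  unfold tailWeight
  have hv : (0 : ℝ) < max 1 |v| := by positivity
  have hu : (0 : ℝ) < max 1 |u| := by positivity
  have e : K ^ (1 + α) * max 1 |v| ^ (-1 - α) = (max 1 |v| / K) ^ (-1 - α) := by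
    rw [Real.div_rpow hv.le hK.le, div_eq_mul_inv, ← Real.rpow_neg hK.le, mul_comm]
    congr 2
    ring
  rw [e]
  refine Real.rpow_le_rpow_of_nonpos (by positivity) ?_ (by linarith)
  rw [div_le_iff₀ hK]
  linarith

theorem tailWeight_le_of_abs_le {α : ℝ} (h0 : 0 < α) {K u v : ℝ} (hK : 1 ≤ K)
    (h : |v| ≤ K * |u|) : tailWeight α u ≤ K ^ (1 + α) * tailWeight α v := by
  refine tailWeight_le_of_max_le h0 (by linarith) (max_le ?_ ?_)
  · nlinarith [le_max_left 1 |u|]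
  · nlinarith [le_max_right 1 |u|]

theorem tailWeight_sub_le {α : ℝ} (h0 : 0 < α) {u v r : ℝ} (hr : 0 ≤ r) (h : |v - u| ≤ r) :
    tailWeight α u ≤ (1 + r) ^ (1 + α) * tailWeight α v := by
  refine tailWeight_le_of_max_le h0 (by linarith) (max_le ?_ ?_)
  · nlinarith [le_max_left 1 |u|]
  · have : |v| ≤ |v - u| + |u| := by simpa using abs_add_le (v - u) u
    nlinarith [le_max_left 1 |u|, le_max_right 1 |u|]

/-- One of |u|, |v − u| is at least |v| / 2, so one factor is at most 2^(1+α) times the weight at v.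
Integrated in u, this says that the weight convolved with itself is at most a multiple of itself; in
discrete form it also drives the Poincaré inequality. -/
theorem tailWeight_mul_le {α : ℝ} (h0 : 0 < α) (u v : ℝ) :
    tailWeight α u * tailWeight α (v - u) ≤
      2 ^ (1 + α) * tailWeight α v * (tailWeight α u + tailWeight α (v - u)) := by
  have hv := tailWeight_pos α v
  have hu := tailWeight_pos α u
  have hvu := tailWeight_pos α (v - u)
  have h2 : (0 : ℝ) < 2 ^ (1 + α) := by positivity
  have htri : |v| ≤ |v - u| + |u| := by simpa using abs_add_le (v - u) u
  rcases le_total |u| |v - u| with h | h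
  · have := tailWeight_le_of_abs_le h0 (K := 2) (by norm_num) (by linarith : |v| ≤ 2 * |v - u|)
    have := mul_le_mul_of_nonneg_left this hu.le
    have : 0 < 2 ^ (1 + α) * tailWeight α v * tailWeight α (v - u) := by positivity
    linarith
  · have := tailWeight_le_of_abs_le h0 (K := 2) (by norm_num) (by linarith : |v| ≤ 2 * |u|)
    have := mul_le_mul_of_nonneg_right this hvu.le
    have : 0 < 2 ^ (1 + α) * tailWeight α v * tailWeight α u := by positivity
    linarith

theorem integrable_tailWeight {α : ℝ} (h0 : 0 < α) : Integrable (tailWeight α) := by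
  have h := integrable_one_add_norm (E := ℝ) (μ := volume) (r := 1 + α) (by simpa using h0)
  refine (h.const_mul (2 ^ (1 + α))).mono' (continuous_tailWeight α).aestronglyMeasurable
    (ae_of_all _ fun v => ?_)
  rw [Real.norm_of_nonneg (tailWeight_pos α v).le, tailWeight, show -(1 + α) = -1 - α by ring]
  have e : (2 : ℝ) ^ (1 + α) * (1 + ‖v‖) ^ (-1 - α) = ((1 + ‖v‖) / 2) ^ (-1 - α) := by
    rw [Real.div_rpow (by positivity) (by norm_num), div_eq_mul_inv,
      ← Real.rpow_neg (by norm_num), mul_comm]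
    congr 2
    ring
  rw [e]
  refine Real.rpow_le_rpow_of_nonpos (by positivity) ?_ (by linarith)
  rw [Real.norm_eq_abs, div_le_iff₀ (by norm_num)]
  linarith [le_max_left 1 |v|, le_max_right 1 |v|]

theorem integrable_tailWeight_mul {α : ℝ} (h0 : 0 < α) {f : ℝ → ℝ} (hf : Continuous f) {C : ℝ}
    (hC : ∀ x, |f x| ≤ C) (v : ℝ) : Integrable fun y => tailWeight α y * f (v - y) :=
  ((integrable_tailWeight h0).bdd_mul (c := C) (f := fun y => f (v - y))
    (by fun_prop) (ae_of_all _ fun y => hC _)).congr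
    (ae_of_all _ fun y => mul_comm _ _)

theorem integral_tailWeight_mul_le {α : ℝ} (h0 : 0 < α) (v : ℝ) :
    ∫ y, tailWeight α y * tailWeight α (v - y) ≤
      (2 ^ (1 + α) * (2 * ∫ y, tailWeight α y)) * tailWeight α v := by
  have hi := integrable_tailWeight h0
  have hi2 : Integrable fun y => tailWeight α (v - y) := hi.comp_sub_left v
  refine (integral_mono (integrable_tailWeight_mul h0 (continuous_tailWeight α) (C := 1)
    (fun x => by rw [abs_of_pos (tailWeight_pos α x)]; exact tailWeight_le_one h0 x) v)
    ((hi.add hi2).const_mul (2 ^ (1 + α) * tailWeight α v))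
    fun y => tailWeight_mul_le h0 y v).trans_eq ?_
  rw [integral_const_mul]
  simp only [Pi.add_apply]
  rw [integral_add hi hi2, integral_sub_left_eq_self (tailWeight α)]
  ring

/-- Two-sided tail bounds for the density of the sum of a compound Poisson variable with jump
density `κ * tailWeight α` and a variable with a nonnegative, fast decaying density. -/
theorem cosT_mul_exp_bounds {α : ℝ} (h0 : 0 < α) {m : ℝ → ℝ} (hm : Integrable m) {κ : ℝ}
    (hκ : 0 < κ) (hnn : ∀ v, 0 ≤ cosT m v) (hpos : 0 < cosT m 0) {C : ℝ}
    (hC : ∀ v, cosT m v ≤ C * tailWeight α v) :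
    ∃ c C' : ℝ, 0 < c ∧ ∀ v,
      c * tailWeight α v ≤
        cosT (fun ξ => m ξ * Real.exp (cosT (fun y => κ * tailWeight α y) ξ)) v ∧
      cosT (fun ξ => m ξ * Real.exp (cosT (fun y => κ * tailWeight α y) ξ)) v ≤
        C' * tailWeight α v := by
  set p : ℝ → ℝ := fun y => κ * tailWeight α y with hpdef
  have hp : Integrable p := (integrable_tailWeight h0).const_mul κ
  have he : ∀ y, p (-y) = p y := fun y => by simp only [hpdef, tailWeight_neg]
  set u : ℕ → ℝ → ℝ := fun n => cosT fun ξ => m ξ * cosT p ξ ^ n with hu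
  have huI : ∀ n, Integrable fun ξ => m ξ * cosT p ξ ^ n := fun n =>
    (cosT_mul_pow_succ hm hp he n).1
  have huc : ∀ n, Continuous (u n) := fun n => continuous_cosT (huI n)
  have hus : ∀ n v, u (n + 1) v = κ * ∫ y, tailWeight α y * u n (v - y) := fun n v => by
    have := (cosT_mul_pow_succ hm hp he n).2 v
    simp only [hpdef, mul_assoc, integral_const_mul] at this
    exact this
  have hu0 : u 0 = cosT m := by simp [hu]
  have hunn : ∀ n v, 0 ≤ u n v := fun n => by
    induction n with
    | zero => simpa [hu0] using hnn
    | succ n ih =>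
      intro v
      rw [hus]
      exact mul_nonneg hκ.le (integral_nonneg fun y => mul_nonneg (tailWeight_pos _ _).le (ih _))
  have hint : ∀ n v, Integrable fun y => tailWeight α y * u n (v - y) := fun n v =>
    integrable_tailWeight_mul h0 (huc n) (fun x => abs_cosT_le (huI n) x) v
  set A := κ * (2 ^ (1 + α) * (2 * ∫ y, tailWeight α y)) with hA
  have hC0 : 0 ≤ C := by
    have h1 := hC 0
    have h2 := tailWeight_pos α 0
    by_contra h
    nlinarith
  have hub : ∀ n v, u n v ≤ C * A ^ n * tailWeight α v := fun n => by
    induction n with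
    | zero => simpa [hu0] using hC
    | succ n ih =>
      intro v
      have hA0 : 0 ≤ A := by
        have : 0 ≤ ∫ y, tailWeight α y := integral_nonneg fun y => (tailWeight_pos α y).le
        positivity
      rw [hus]
      have : ∫ y, tailWeight α y * u n (v - y) ≤
          ∫ y, C * A ^ n * (tailWeight α y * tailWeight α (v - y)) := by
        refine integral_mono (hint n v) ((integrable_tailWeight_mul h0 (continuous_tailWeight α)
          (C := 1) (fun x => by
            rw [abs_of_pos (tailWeight_pos α x)]; exact tailWeight_le_one h0 x) v).const_mul _)
          fun y => ?_
        have := mul_le_mul_of_nonneg_left (ih (v - y)) (tailWeight_pos α y).le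
        linarith
      rw [integral_const_mul] at this
      calc _ ≤ κ * (C * A ^ n * ∫ y, tailWeight α y * tailWeight α (v - y)) :=
            mul_le_mul_of_nonneg_left this hκ.le
        _ ≤ κ * (C * A ^ n * ((2 ^ (1 + α) * (2 * ∫ y, tailWeight α y)) * tailWeight α v)) := by
            refine mul_le_mul_of_nonneg_left (mul_le_mul_of_nonneg_left
              (integral_tailWeight_mul_le h0 v) (by positivity)) hκ.le
        _ = _ := by rw [pow_succ, hA]; ring
  have hsum : ∀ v, HasSum (fun n : ℕ => u n v / n.factorial) _ := fun v =>
    hasSum_cosT_mul_exp hm hp he v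
  have hexp : HasSum (fun n : ℕ => A ^ n / n.factorial) (Real.exp A) := by
    rw [Real.exp_eq_exp_ℝ]
    exact NormedSpace.expSeries_div_hasSum_exp A
  -- The density without jumps stays away from 0 near the origin. A single jump landing within r of
  -- v therefore already has mass of order `tailWeight α v`.
  obtain ⟨r, hr0, hr1, hr⟩ : ∃ r : ℝ, 0 < r ∧ r ≤ 1 ∧ ∀ x, |x| < r → cosT m 0 / 2 ≤ u 0 x := by
    have hev : ∀ᶠ x in nhds (0 : ℝ), cosT m 0 / 2 < u 0 x :=
      (huc 0).continuousAt.eventually (lt_mem_nhds (by rw [hu0]; linarith))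
    obtain ⟨r, hr, hr'⟩ := Metric.eventually_nhds_iff.1 hev
    refine ⟨min r 1, lt_min hr one_pos, min_le_right _ _, fun x hx => (hr' ?_).le⟩
    rw [Real.dist_0_eq_abs]
    exact lt_of_lt_of_le hx (min_le_left _ _)
  have h2p : (0 : ℝ) < 2 ^ (1 + α) := by positivity
  refine ⟨κ * ((cosT m 0 / 2) * (2 * r) / 2 ^ (1 + α)), C * Real.exp A, by positivity,
    fun v => ⟨?_, ?_⟩⟩
  -- All terms are nonnegative, so only the one-jump term is kept for the lower bound.
  · have h1 : u 1 v ≤ cosT (fun ξ => m ξ * Real.exp (cosT p ξ)) v := by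
      have := le_hasSum (hsum v) 1 fun n _ => div_nonneg (hunn n v) (Nat.cast_nonneg _)
      simpa using this
    refine le_trans ?_ h1
    rw [hus 0, mul_assoc]
    refine mul_le_mul_of_nonneg_left ?_ hκ.le
    have h3 : ∫ y in Set.Ioo (v - r) (v + r), (cosT m 0 / 2) * (tailWeight α v / 2 ^ (1 + α)) ≤
        ∫ y in Set.Ioo (v - r) (v + r), tailWeight α y * u 0 (v - y) := by
      refine setIntegral_mono_on
        (integrableOn_const (by simp)) (hint 0 v).integrableOn measurableSet_Ioo
        fun y hy => ?_
      have hvy : |v - y| < r := abs_lt.2 ⟨by linarith [hy.2], by linarith [hy.1]⟩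
      have hw := tailWeight_sub_le h0 (u := v) (v := y) (r := 1) zero_le_one
        (by rw [abs_sub_comm]; linarith)
      rw [show (1 : ℝ) + 1 = 2 by norm_num] at hw
      rw [mul_comm]
      refine mul_le_mul ?_ (hr _ hvy) (by linarith) (tailWeight_pos _ _).le
      rw [div_le_iff₀ h2p]
      linarith
    have h4 : ∫ y in Set.Ioo (v - r) (v + r), tailWeight α y * u 0 (v - y) ≤
        ∫ y, tailWeight α y * u 0 (v - y) :=
      setIntegral_le_integral (hint 0 v)
        (ae_of_all _ fun y => mul_nonneg (tailWeight_pos _ _).le (hunn 0 _))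
    refine le_trans (le_of_eq ?_) (h3.trans h4)
    rw [setIntegral_const, smul_eq_mul, Measure.real, Real.volume_Ioo,
      ENNReal.toReal_ofReal (by linarith)]
    ring
  · refine hasSum_le (fun n => ?_) (hsum v) ((hexp.mul_left C).mul_right (tailWeight α v))
    rw [div_le_iff₀ (by positivity)]
    refine (hub n v).trans_eq ?_
    field_simp

/-! ### Lévy–Khintchine splitting into small and large jumps. -/

/-- The part of the jump density `|y| ^ (-1 - α)` that is left after the subtraction of
`tailWeight`; it is supported in `[-1, 1]`. -/
def smallJump (α y : ℝ) : ℝ := |y| ^ (-1 - α) - tailWeight α y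

theorem smallJump_neg (α y : ℝ) : smallJump α (-y) = smallJump α y := by
  simp [smallJump, tailWeight_neg]

theorem smallJump_eq_zero {α y : ℝ} (hy : 1 ≤ |y|) : smallJump α y = 0 := by
  simp [smallJump, tailWeight, max_eq_right hy]

/-- The origin is excluded because the default value 0^(−1−α) = 0 makes `smallJump α 0` equal to −1.
-/
theorem smallJump_nonneg {α y : ℝ} (h0 : 0 < α) (hy : y ≠ 0) : 0 ≤ smallJump α y :=
  sub_nonneg.2 <| Real.rpow_le_rpow_of_nonpos (abs_pos.2 hy) (le_max_right _ _) (by linarith)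

theorem smallJump_le (α y : ℝ) : smallJump α y ≤ |y| ^ (-1 - α) :=
  sub_le_self _ (tailWeight_pos α y).le

theorem measurable_smallJump (α : ℝ) : Measurable (smallJump α) :=
  (by fun_prop : Measurable fun y : ℝ => |y| ^ (-1 - α)).sub (continuous_tailWeight α).measurable

theorem integrable_indicator_abs_rpow {r : ℝ} (hr : -1 < r) :
    Integrable ((Metric.ball (0 : ℝ) 1).indicator fun y => |y| ^ r) := by
  rw [integrable_indicator_iff measurableSet_ball]
  have := (integrableOn_fun_norm_addHaar (E := ℝ) (μ := volume) (f := fun y : ℝ => y ^ r)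
    (r := 1)).2 ?_
  · exact this
  · simpa using (intervalIntegral.integrableOn_Ioo_rpow_iff (zero_lt_one)).2 hr

theorem integrable_sq_mul_smallJump {α : ℝ} (h0 : 0 < α) (h2 : α < 2) :
    Integrable fun y => y ^ 2 * smallJump α y := by
  refine (integrable_indicator_abs_rpow (r := 1 - α) (by linarith)).mono'
    ((by fun_prop : Measurable fun y : ℝ => y ^ 2).mul
      (measurable_smallJump α)).aestronglyMeasurable (ae_of_all _ fun y => ?_)
  rcases eq_or_ne y 0 with rfl | hy
  · simp only [ne_eq, OfNat.ofNat_ne_zero, not_false_eq_true, zero_pow, zero_mul, norm_zero]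
    exact Set.indicator_nonneg (fun y _ => by positivity) _
  by_cases h1 : 1 ≤ |y|
  · rw [smallJump_eq_zero h1, mul_zero, norm_zero]
    exact Set.indicator_nonneg (fun y _ => by positivity) _
  · rw [Set.indicator_of_mem (by simpa using not_le.1 h1),
      Real.norm_of_nonneg (mul_nonneg (sq_nonneg _) (smallJump_nonneg h0 hy))]
    refine (mul_le_mul_of_nonneg_left (smallJump_le α y) (sq_nonneg y)).trans_eq ?_
    rw [← sq_abs, ← Real.rpow_natCast, ← Real.rpow_add (abs_pos.2 hy)]
    congr 1
    push_cast
    ring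

theorem one_sub_cos_le (x : ℝ) : 1 - Real.cos x ≤ x ^ 2 / 2 := by
  linarith [Real.one_sub_sq_div_two_le_cos (x := x)]

theorem integrable_one_sub_cos_mul_smallJump {α : ℝ} (h0 : 0 < α) (h2 : α < 2) (ξ : ℝ) :
    Integrable fun y => (1 - Real.cos (ξ * y)) * smallJump α y := by
  refine ((integrable_sq_mul_smallJump h0 h2).norm.const_mul (ξ ^ 2 / 2)).mono'
    ((by fun_prop : Measurable fun y : ℝ => 1 - Real.cos (ξ * y)).mul
      (measurable_smallJump α)).aestronglyMeasurable (ae_of_all _ fun y => ?_)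
  rw [norm_mul, norm_mul, ← mul_assoc]
  refine mul_le_mul_of_nonneg_right ?_ (norm_nonneg _)
  rw [Real.norm_of_nonneg (by linarith [Real.cos_le_one (ξ * y)]),
    Real.norm_of_nonneg (sq_nonneg y)]
  refine (one_sub_cos_le _).trans_eq ?_
  ring

/-- The characteristic exponent of the small jumps. -/
def smallSymbol (α ξ : ℝ) : ℝ := ∫ y, (1 - Real.cos (ξ * y)) * smallJump α y

/-- The constant in the Lévy–Khintchine representation of `|ξ| ^ α`. -/
def levyConst (α : ℝ) : ℝ := ∫ y : ℝ, (1 - Real.cos y) * |y| ^ (-1 - α)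

theorem integrable_one_sub_cos_mul_rpow {α : ℝ} (h0 : 0 < α) (h2 : α < 2) (ξ : ℝ) :
    Integrable fun y : ℝ => (1 - Real.cos (ξ * y)) * |y| ^ (-1 - α) := by
  have hW := integrable_tailWeight h0
  refine ((integrable_one_sub_cos_mul_smallJump h0 h2 ξ).add
    (hW.sub (integrable_cos_mul hW ξ))).congr (ae_of_all _ fun y => ?_)
  simp only [Pi.add_apply, Pi.sub_apply, smallJump]
  ring

theorem levyConst_pos {α : ℝ} (h0 : 0 < α) (h2 : α < 2) : 0 < levyConst α := by
  have hi := integrable_one_sub_cos_mul_rpow h0 h2 1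
  simp only [one_mul] at hi
  rw [levyConst, integral_pos_iff_support_of_nonneg
    (fun y => mul_nonneg (by linarith [Real.cos_le_one y]) (by positivity)) hi]
  refine lt_of_lt_of_le ?_ (measure_mono (?_ : Set.Ioo (0 : ℝ) 1 ⊆ _))
  · simp
  · intro y hy
    refine mul_ne_zero ?_ (Real.rpow_pos_of_pos (abs_pos.2 hy.1.ne') _).ne'
    have : Real.cos y < Real.cos 0 :=
      Real.cos_lt_cos_of_nonneg_of_le_pi le_rfl (by linarith [Real.pi_gt_three, hy.2]) hy.1
    rw [Real.cos_zero] at this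
    linarith

/-- Substituting y ↦ ξ y, the density |y|^(−1−α) dy is homogeneous and produces the factor |ξ|^α. -/
theorem integral_one_sub_cos_mul_rpow {α : ℝ} (h0 : 0 < α) (ξ : ℝ) :
    ∫ y : ℝ, (1 - Real.cos (ξ * y)) * |y| ^ (-1 - α) = |ξ| ^ α * levyConst α := by
  rcases eq_or_ne ξ 0 with rfl | hξ
  · simp [h0.ne']
  have hp := abs_pos.2 hξ
  have := Measure.integral_comp_mul_left (fun y : ℝ => (1 - Real.cos y) * |y| ^ (-1 - α)) ξ
  rw [smul_eq_mul, abs_inv, ← levyConst] at this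
  have e : ∀ y : ℝ, (1 - Real.cos (ξ * y)) * |ξ * y| ^ (-1 - α) =
      |ξ| ^ (-1 - α) * ((1 - Real.cos (ξ * y)) * |y| ^ (-1 - α)) := fun y => by
    rw [abs_mul, Real.mul_rpow hp.le (abs_nonneg y)]
    ring
  simp only [e, integral_const_mul] at this
  have e2 : |ξ| ^ (-1 - α) = |ξ|⁻¹ * (|ξ| ^ α)⁻¹ := by
    rw [sub_eq_add_neg, Real.rpow_add hp, Real.rpow_neg_one, Real.rpow_neg hp.le]
  have h3 : (|ξ| ^ α) ≠ 0 := (Real.rpow_pos_of_pos hp _).ne'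
  rw [e2] at this
  field_simp at this
  linarith

/-- Lévy–Khintchine decomposition of `|ξ| ^ α` into small and large jumps. -/
theorem rpow_mul_levyConst {α : ℝ} (h0 : 0 < α) (h2 : α < 2) (ξ : ℝ) :
    |ξ| ^ α * levyConst α =
      smallSymbol α ξ + ((∫ y, tailWeight α y) - cosT (tailWeight α) ξ) := by
  have hW := integrable_tailWeight h0
  have hd : Integrable fun y => tailWeight α y - Real.cos (ξ * y) * tailWeight α y :=
    hW.sub (integrable_cos_mul hW ξ)
  rw [← integral_one_sub_cos_mul_rpow h0 ξ, smallSymbol, cosT,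
    ← integral_sub hW (integrable_cos_mul hW ξ),
    ← integral_add (integrable_one_sub_cos_mul_smallJump h0 h2 ξ) hd]
  refine integral_congr_ae (ae_of_all _ fun y => ?_)
  simp only [smallJump]
  ring

/-- The normalisation of the jump density for the exponent `|ξ| ^ α / α`. -/
def jumpConst (α : ℝ) : ℝ := (α * levyConst α)⁻¹

theorem jumpConst_pos {α : ℝ} (h0 : 0 < α) (h2 : α < 2) : 0 < jumpConst α :=
  inv_pos.2 (mul_pos h0 (levyConst_pos h0 h2))

/-- The characteristic function of the small jumps. -/
def smallChar (α ξ : ℝ) : ℝ := Real.exp (-(jumpConst α * smallSymbol α ξ))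

theorem jumpConst_mul_smallSymbol {α : ℝ} (h0 : 0 < α) (h2 : α < 2) (ξ : ℝ) :
    jumpConst α * smallSymbol α ξ = |ξ| ^ α / α - jumpConst α * (∫ y, tailWeight α y) +
      cosT (fun y => jumpConst α * tailWeight α y) ξ := by
  have h := rpow_mul_levyConst h0 h2 ξ
  have e : cosT (fun y => jumpConst α * tailWeight α y) ξ =
      jumpConst α * cosT (tailWeight α) ξ := by
    simp only [cosT, mul_left_comm _ (jumpConst α), integral_const_mul]
  have hl := (levyConst_pos h0 h2).ne'
  have e2 : jumpConst α * (|ξ| ^ α * levyConst α) = |ξ| ^ α / α := by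
    rw [jumpConst]
    field_simp
  rw [e, ← e2, h]
  ring

/-- The stable characteristic function is that of the small jumps times a compound Poisson factor.
This is the shape required by `cosT_mul_exp_bounds`. -/
theorem smallChar_mul_exp {α : ℝ} (h0 : 0 < α) (h2 : α < 2) (ξ : ℝ) :
    Real.exp (-(|ξ| ^ α / α)) = Real.exp (-(jumpConst α * ∫ y, tailWeight α y)) *
      (smallChar α ξ * Real.exp (cosT (fun y => jumpConst α * tailWeight α y) ξ)) := by
  rw [smallChar, ← Real.exp_add, ← Real.exp_add, jumpConst_mul_smallSymbol h0 h2]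
  congr 1
  ring

/-- The compound Poisson factor is bounded below, since the cosine transform of an integrable
function is bounded. Removing it therefore keeps the decay of the stable characteristic function. -/
theorem smallChar_le {α : ℝ} (h0 : 0 < α) (h2 : α < 2) :
    ∃ C : ℝ, ∀ ξ, smallChar α ξ ≤ C * Real.exp (-(|ξ| ^ α / α)) := by
  set I := ∫ y, |jumpConst α * tailWeight α y|
  refine ⟨Real.exp (jumpConst α * (∫ y, tailWeight α y) + I), fun ξ => ?_⟩
  rw [smallChar, ← Real.exp_add, Real.exp_le_exp, jumpConst_mul_smallSymbol h0 h2]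
  have := abs_cosT_le ((integrable_tailWeight h0).const_mul (jumpConst α)) ξ
  linarith [neg_abs_le (cosT (fun y => jumpConst α * tailWeight α y) ξ)]

theorem pow_mul_exp_neg_rpow_le {α : ℝ} (h0 : 0 < α) (k : ℕ) :
    ∃ C : ℝ, ∀ ξ : ℝ, (1 + |ξ|) ^ k * Real.exp (-(|ξ| ^ α / α)) ≤ C := by
  -- With nα ≥ k, the single term xⁿ/n! of the exponential at x = |ξ|^α/α absorbs |ξ|^k.
  obtain ⟨n, hn⟩ := exists_nat_gt (k / α)
  have hn' : (k : ℝ) ≤ α * n := by rw [div_lt_iff₀ h0] at hn; linarith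
  refine ⟨max (2 ^ k) (2 ^ k * (α ^ n * n.factorial)), fun ξ => ?_⟩
  have hA : 0 ≤ |ξ| ^ α / α := by positivity
  rcases le_total |ξ| 1 with h | h
  · refine le_trans ?_ (le_max_left _ _)
    have h1 : (1 + |ξ|) ^ k ≤ 2 ^ k := pow_le_pow_left₀ (by positivity) (by linarith) k
    have h2 : Real.exp (-(|ξ| ^ α / α)) ≤ 1 := Real.exp_le_one_iff.2 (by linarith)
    nlinarith [Real.exp_pos (-(|ξ| ^ α / α)), (by positivity : (0 : ℝ) < 2 ^ k)]
  · refine le_trans ?_ (le_max_right _ _)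
    have h1 : (1 + |ξ|) ^ k ≤ 2 ^ k * |ξ| ^ k := by
      rw [← mul_pow]
      exact pow_le_pow_left₀ (by positivity) (by linarith) k
    have h2 := Real.pow_div_factorial_le_exp _ hA n
    have h3 : |ξ| ^ k ≤ (|ξ| ^ α) ^ n := by
      rw [← Real.rpow_natCast, ← Real.rpow_natCast, ← Real.rpow_mul (abs_nonneg _)]
      exact Real.rpow_le_rpow_of_exponent_le h hn'
    rw [Real.exp_neg, ← div_eq_mul_inv, div_le_iff₀ (Real.exp_pos _)]
    have h4 : (|ξ| ^ α) ^ n ≤ α ^ n * n.factorial * Real.exp (|ξ| ^ α / α) := by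
      rw [div_pow, div_div, div_le_iff₀ (by positivity)] at h2
      linarith
    calc (1 + |ξ|) ^ k ≤ 2 ^ k * |ξ| ^ k := h1
      _ ≤ 2 ^ k * (α ^ n * n.factorial * Real.exp (|ξ| ^ α / α)) :=
        mul_le_mul_of_nonneg_left (h3.trans h4) (by positivity)
      _ = _ := by ring

theorem pow_mul_smallChar_le {α : ℝ} (h0 : 0 < α) (h2 : α < 2) (k : ℕ) :
    ∃ C : ℝ, ∀ ξ : ℝ, (1 + |ξ|) ^ k * smallChar α ξ ≤ C := by
  obtain ⟨C, hC⟩ := pow_mul_exp_neg_rpow_le h0 k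
  obtain ⟨D, hD⟩ := smallChar_le h0 h2
  have hD0 : 0 ≤ D := by
    by_contra h
    have h1 := hD 0
    have h3 : 0 < smallChar α 0 := Real.exp_pos _
    nlinarith [Real.exp_pos (-(|(0 : ℝ)| ^ α / α))]
  refine ⟨D * C, fun ξ => ?_⟩
  calc _ ≤ (1 + |ξ|) ^ k * (D * Real.exp (-(|ξ| ^ α / α))) :=
        mul_le_mul_of_nonneg_left (hD ξ) (by positivity)
    _ = D * ((1 + |ξ|) ^ k * Real.exp (-(|ξ| ^ α / α))) := by ring
    _ ≤ D * C := mul_le_mul_of_nonneg_left (hC ξ) hD0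

/-! ### Smoothness and decay of the small-jump characteristic function. -/

/-- Higher derivatives are controlled without computing them: it is enough to find a class of
functions that is stable under differentiation and whose members all satisfy the desired bound. -/
theorem iteratedDeriv_mem_of_deriv_mem {F : Type*} [NormedAddCommGroup F] [NormedSpace ℝ F]
    {A : Set (ℝ → F)} (hA : ∀ f ∈ A, Differentiable ℝ f ∧ deriv f ∈ A) (n : ℕ) :
    ∀ f ∈ A, iteratedDeriv n f ∈ A := by
  induction n with
  | zero => intro f hf; simpa using hf
  | succ n ih =>
    intro f hf
    rw [iteratedDeriv_succ']
    exact ih _ (hA f hf).2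

theorem contDiff_of_deriv_mem {F : Type*} [NormedAddCommGroup F] [NormedSpace ℝ F]
    {A : Set (ℝ → F)} (hA : ∀ f ∈ A, Differentiable ℝ f ∧ deriv f ∈ A) {f : ℝ → F} (hf : f ∈ A) :
    ContDiff ℝ (⊤ : ℕ∞) f :=
  contDiff_of_differentiable_iteratedDeriv fun n _ =>
    (hA _ (iteratedDeriv_mem_of_deriv_mem hA n f hf)).1

theorem hasTemperateGrowth_of_deriv_mem {A : Set (ℝ → ℝ)}
    (hA : ∀ f ∈ A, Differentiable ℝ f ∧ deriv f ∈ A)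
    (hb : ∀ f ∈ A, ∃ (k : ℕ) (C : ℝ), ∀ x, |f x| ≤ C * (1 + |x|) ^ k) {f : ℝ → ℝ} (hf : f ∈ A) :
    Function.HasTemperateGrowth f := by
  refine ⟨contDiff_of_deriv_mem hA hf, fun n => ?_⟩
  obtain ⟨k, C, h⟩ := hb _ (iteratedDeriv_mem_of_deriv_mem hA n f hf)
  refine ⟨k, C, fun x => ?_⟩
  rw [norm_iteratedFDeriv_eq_norm_iteratedDeriv]
  exact h x

theorem hasTemperateGrowth_deriv {f : ℝ → ℝ} (hf : Function.HasTemperateGrowth f) :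
    Function.HasTemperateGrowth (deriv f) := by
  refine ⟨?_, fun n => ?_⟩
  · have := hf.1
    exact (contDiff_infty_iff_deriv.1 this).2
  · obtain ⟨k, C, h⟩ := hf.2 (n + 1)
    refine ⟨k, C, fun x => ?_⟩
    have := h x
    rw [norm_iteratedFDeriv_eq_norm_iteratedDeriv] at this ⊢
    rwa [iteratedDeriv_succ'] at this

/-- The sine transform. -/
def sinT (m : ℝ → ℝ) (v : ℝ) : ℝ := ∫ ξ, Real.sin (v * ξ) * m ξ

theorem hasDerivAt_cosT {Q : ℝ → ℝ} (hQ : Integrable Q) (hyQ : Integrable fun y => y * Q y)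
    (ξ : ℝ) : HasDerivAt (cosT Q) (sinT (fun y => -(y * Q y)) ξ) ξ := by
  refine (hasDerivAt_integral_of_dominated_loc_of_deriv_le (s := Set.univ)
    (F' := fun ξ y => Real.sin (ξ * y) * -(y * Q y)) (bound := fun y => ‖y * Q y‖)
    Filter.univ_mem (Filter.Eventually.of_forall fun ξ =>
      (integrable_cos_mul hQ ξ).aestronglyMeasurable) (integrable_cos_mul hQ ξ) ?_ ?_ hyQ.norm ?_).2
  · exact (by fun_prop : Measurable fun y : ℝ => Real.sin (ξ * y)).aestronglyMeasurable.mul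
      hyQ.neg.aestronglyMeasurable
  · refine ae_of_all _ fun y x _ => ?_
    rw [norm_mul, norm_neg]
    exact mul_le_of_le_one_left (norm_nonneg _) (Real.abs_sin_le_one _)
  · refine ae_of_all _ fun y x _ => ?_
    have := ((Real.hasDerivAt_cos (x * y)).comp x ((hasDerivAt_id x).mul_const y)).mul_const (Q y)
    refine this.congr_deriv ?_
    ring

theorem integrable_sin_mul {R : ℝ → ℝ} (hR : AEStronglyMeasurable R)
    (hyR : Integrable fun y => y * R y) (ξ : ℝ) :
    Integrable fun y => Real.sin (ξ * y) * R y := by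
  refine (hyR.norm.const_mul |ξ|).mono' ((by fun_prop : Measurable fun y : ℝ =>
    Real.sin (ξ * y)).aestronglyMeasurable.mul hR) (ae_of_all _ fun y => ?_)
  rw [norm_mul, norm_mul, ← mul_assoc, Real.norm_eq_abs, Real.norm_eq_abs y, ← abs_mul]
  exact mul_le_mul_of_nonneg_right Real.abs_sin_le_abs (norm_nonneg _)

theorem hasDerivAt_sinT {R : ℝ → ℝ} (hR : AEStronglyMeasurable R)
    (hyR : Integrable fun y => y * R y) (ξ : ℝ) :
    HasDerivAt (sinT R) (cosT (fun y => y * R y) ξ) ξ := by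
  refine (hasDerivAt_integral_of_dominated_loc_of_deriv_le (s := Set.univ)
    (F' := fun ξ y => Real.cos (ξ * y) * (y * R y)) (bound := fun y => ‖y * R y‖)
    Filter.univ_mem (Filter.Eventually.of_forall fun ξ =>
      (integrable_sin_mul hR hyR ξ).aestronglyMeasurable) (integrable_sin_mul hR hyR ξ)
      (integrable_cos_mul hyR ξ).aestronglyMeasurable ?_ hyR.norm ?_).2
  · refine ae_of_all _ fun y x _ => ?_
    rw [norm_mul]
    exact mul_le_of_le_one_left (norm_nonneg _) (Real.abs_cos_le_one _)
  · refine ae_of_all _ fun y x _ => ?_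
    have := ((Real.hasDerivAt_sin (x * y)).comp x ((hasDerivAt_id x).mul_const y)).mul_const (R y)
    refine this.congr_deriv ?_
    ring

theorem hasDerivAt_smallSymbol {α : ℝ} (h0 : 0 < α) (h2 : α < 2) (ξ : ℝ) :
    HasDerivAt (smallSymbol α) (sinT (fun y => y * smallJump α y) ξ) ξ := by
  have hQ := integrable_sq_mul_smallJump h0 h2
  -- Near 0 only y² `smallJump` is integrable, so the sine must supply a factor |x y|. The
  -- dominating function then grows with |x|, whence a bounded neighbourhood of ξ.
  refine (hasDerivAt_integral_of_dominated_loc_of_deriv_le (s := Metric.ball ξ 1)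
    (F' := fun ξ y => Real.sin (ξ * y) * (y * smallJump α y))
    (bound := fun y => (|ξ| + 1) * ‖y ^ 2 * smallJump α y‖)
    (Metric.ball_mem_nhds _ one_pos) (Filter.Eventually.of_forall fun ξ =>
      (integrable_one_sub_cos_mul_smallJump h0 h2 ξ).aestronglyMeasurable)
      (integrable_one_sub_cos_mul_smallJump h0 h2 ξ)
      ?_ ?_ (hQ.norm.const_mul _) ?_).2
  · exact ((by fun_prop : Measurable fun y : ℝ => Real.sin (ξ * y)).mul
      (measurable_id.mul (measurable_smallJump α))).aestronglyMeasurable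
  · refine ae_of_all _ fun y x hx => ?_
    rw [norm_mul, norm_mul, norm_mul, norm_pow, ← mul_assoc, ← mul_assoc]
    refine mul_le_mul_of_nonneg_right ?_ (norm_nonneg _)
    have h1 : |Real.sin (x * y)| ≤ |x| * |y| := by
      rw [← abs_mul]; exact Real.abs_sin_le_abs
    have h3 : |x| ≤ |ξ| + 1 := by
      have := abs_add_le (x - ξ) ξ
      rw [sub_add_cancel] at this
      have h4 : |x - ξ| < 1 := by simpa [Real.dist_eq] using hx
      linarith
    simp only [Real.norm_eq_abs]
    calc |Real.sin (x * y)| * |y| ≤ (|x| * |y|) * |y| :=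
          mul_le_mul_of_nonneg_right h1 (abs_nonneg _)
      _ = |x| * |y| ^ 2 := by ring
      _ ≤ _ := mul_le_mul_of_nonneg_right h3 (by positivity)
  · refine ae_of_all _ fun y x _ => ?_
    have := (((Real.hasDerivAt_cos (x * y)).comp x ((hasDerivAt_id x).mul_const y)).const_sub
      1).mul_const (smallJump α y)
    refine this.congr_deriv ?_
    ring

theorem integrable_mul_of_support {Q : ℝ → ℝ} (hQ : Integrable Q)
    (hs : ∀ y, 1 ≤ |y| → Q y = 0) : Integrable fun y => y * Q y := by
  refine hQ.norm.mono' (measurable_id.aestronglyMeasurable.mul hQ.aestronglyMeasurable)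
    (ae_of_all _ fun y => ?_)
  rcases le_total 1 |y| with h | h
  · simp [hs y h]
  · rw [norm_mul]
    exact mul_le_of_le_one_left (norm_nonneg _) h

theorem hasTemperateGrowth_sinT_smallJump {α : ℝ} (h0 : 0 < α) (h2 : α < 2) :
    Function.HasTemperateGrowth (sinT fun y => y * smallJump α y) := by
  -- Differentiation swaps sine and cosine transforms and multiplies Q by ±y, harmless on [−1,1].
  -- For sine transforms only y Q is assumed integrable: the starting Q behaves like |y|^(−α) near
  -- 0, not integrable when α ≥ 1.
  set A : Set (ℝ → ℝ) := {f | ∃ Q : ℝ → ℝ, AEStronglyMeasurable Q ∧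
    (∀ y, 1 ≤ |y| → Q y = 0) ∧ (f = sinT Q ∧ Integrable (fun y => y * Q y) ∨
      f = cosT Q ∧ Integrable Q)} with hA
  refine hasTemperateGrowth_of_deriv_mem (A := A) ?_ ?_ ?_
  · rintro f ⟨Q, hm, hs, ⟨rfl, hQ⟩ | ⟨rfl, hQ⟩⟩
    · have hd := hasDerivAt_sinT hm hQ
      refine ⟨fun ξ => (hd ξ).differentiableAt, fun y => y * Q y, hQ.aestronglyMeasurable,
        fun y hy => by simp [hs y hy], Or.inr ⟨?_, hQ⟩⟩
      funext ξ
      exact (hd ξ).deriv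
    · have hyQ := integrable_mul_of_support hQ hs
      have hd := hasDerivAt_cosT hQ hyQ
      refine ⟨fun ξ => (hd ξ).differentiableAt, fun y => -(y * Q y),
        hyQ.neg.aestronglyMeasurable, fun y hy => by simp [hs y hy],
        Or.inl ⟨?_, ?_⟩⟩
      · funext ξ
        exact (hd ξ).deriv
      · exact integrable_mul_of_support hyQ.neg fun y hy => by
          simp [hs y hy]
  · rintro f ⟨Q, hm, hs, ⟨rfl, hQ⟩ | ⟨rfl, hQ⟩⟩
    · refine ⟨1, ∫ y, ‖y * Q y‖, fun ξ => ?_⟩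
      have h1 : |sinT Q ξ| ≤ ∫ y, |ξ| * ‖y * Q y‖ := by
        refine abs_integral_le_integral_abs.trans (integral_mono
          (integrable_sin_mul hm hQ ξ).abs (hQ.norm.const_mul _) fun y => ?_)
        simp only [abs_mul, norm_mul, ← mul_assoc, Real.norm_eq_abs]
        rw [← abs_mul ξ y]
        exact mul_le_mul_of_nonneg_right Real.abs_sin_le_abs (abs_nonneg _)
      rw [integral_const_mul] at h1
      have h3 : 0 ≤ ∫ y, ‖y * Q y‖ := integral_nonneg fun _ => norm_nonneg _
      rw [pow_one]
      linarith
    · refine ⟨0, ∫ y, |Q y|, fun ξ => ?_⟩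
      simpa using abs_cosT_le hQ ξ
  · refine ⟨fun y => y * smallJump α y,
      (measurable_id.mul (measurable_smallJump α)).aestronglyMeasurable,
      fun y hy => by simp [smallJump_eq_zero hy], Or.inl ⟨rfl, ?_⟩⟩
    simpa only [← mul_assoc, ← sq] using integrable_sq_mul_smallJump h0 h2

theorem hasDerivAt_smallChar {α : ℝ} (h0 : 0 < α) (h2 : α < 2) (ξ : ℝ) :
    HasDerivAt (smallChar α)
      (-(jumpConst α * sinT (fun y => y * smallJump α y) ξ) * smallChar α ξ) ξ := by
  refine (((hasDerivAt_smallSymbol h0 h2 ξ).const_mul (jumpConst α)).neg.exp).congr_deriv ?_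
  simp only [smallChar, Pi.neg_apply]
  ring

/-- The characteristic function of the small jumps as a Schwartz function. -/
theorem exists_schwartzMap_smallChar {α : ℝ} (h0 : 0 < α) (h2 : α < 2) :
    ∃ g : SchwartzMap ℝ ℂ, ∀ ξ, g ξ = (smallChar α ξ : ℂ) := by
  -- This class is stable under differentiation because the logarithmic derivative of `smallChar`
  -- has temperate growth. Each member decays rapidly because `smallChar` beats every power.
  set A : Set (ℝ → ℂ) := {f | ∃ P : ℝ → ℝ, Function.HasTemperateGrowth P ∧
    f = fun ξ => ((P ξ * smallChar α ξ : ℝ) : ℂ)} with hA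
  have hclosed : ∀ f ∈ A, Differentiable ℝ f ∧ deriv f ∈ A := by
    rintro f ⟨P, hP, rfl⟩
    set S := sinT fun y => y * smallJump α y
    have hd : ∀ ξ, HasDerivAt (fun ξ => ((P ξ * smallChar α ξ : ℝ) : ℂ))
        (((deriv P ξ + P ξ * ((-jumpConst α) * S ξ)) * smallChar α ξ : ℝ) : ℂ) ξ := fun ξ => by
      have hPd : HasDerivAt P (deriv P ξ) ξ :=
        (hP.1.differentiable (by simp) ξ).hasDerivAt
      refine ((hPd.mul (hasDerivAt_smallChar h0 h2 ξ)).congr_deriv ?_).ofReal_comp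
      ring
    refine ⟨fun ξ => (hd ξ).differentiableAt, _, ?_, funext fun ξ => (hd ξ).deriv⟩
    exact (hasTemperateGrowth_deriv hP).add (hP.mul
      ((Function.HasTemperateGrowth.const (-jumpConst α)).mul
        (hasTemperateGrowth_sinT_smallJump h0 h2)))
  have hmem : (fun ξ => (smallChar α ξ : ℂ)) ∈ A :=
    ⟨fun _ => 1, Function.HasTemperateGrowth.const 1, by simp⟩
  refine ⟨⟨fun ξ => (smallChar α ξ : ℂ), contDiff_of_deriv_mem hclosed hmem, fun k n => ?_⟩,
    fun ξ => rfl⟩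
  obtain ⟨P, hP, hPe⟩ := iteratedDeriv_mem_of_deriv_mem hclosed n _ hmem
  obtain ⟨l, C, hC⟩ := hP.2 0
  obtain ⟨D, hD⟩ := pow_mul_smallChar_le h0 h2 (l + k)
  refine ⟨C * D, fun ξ => ?_⟩
  have hpos : 0 < smallChar α ξ := Real.exp_pos _
  have h1 : |P ξ| ≤ C * (1 + |ξ|) ^ l := by simpa using hC ξ
  have hC0 : 0 ≤ C := by
    have : (0 : ℝ) < (1 + |ξ|) ^ l := by positivity
    have := abs_nonneg (P ξ)
    by_contra h
    nlinarith
  rw [norm_iteratedFDeriv_eq_norm_iteratedDeriv, hPe, Complex.norm_real, norm_mul,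
    Real.norm_eq_abs, Real.norm_eq_abs, Real.norm_of_nonneg hpos.le]
  calc |ξ| ^ k * (|P ξ| * smallChar α ξ)
      ≤ (1 + |ξ|) ^ k * (C * (1 + |ξ|) ^ l * smallChar α ξ) := by
        gcongr
        linarith
    _ = C * ((1 + |ξ|) ^ (l + k) * smallChar α ξ) := by rw [pow_add]; ring
    _ ≤ C * D := mul_le_mul_of_nonneg_left (hD ξ) hC0

theorem integrable_smallChar {α : ℝ} (h0 : 0 < α) (h2 : α < 2) : Integrable (smallChar α) := by
  obtain ⟨g, hg⟩ := exists_schwartzMap_smallChar h0 h2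
  have := g.integrable (μ := volume).re
  refine this.congr (ae_of_all _ fun ξ => ?_)
  simp [hg]

-- The cosine transform is the real part of a Schwartz function, so it decays faster than every
-- power. The power 3 is enough since 1 + α < 3.
open scoped FourierTransform in
theorem cosT_smallChar_le {α : ℝ} (h0 : 0 < α) (h2 : α < 2) :
    ∃ C : ℝ, ∀ v, cosT (smallChar α) v ≤ C * tailWeight α v := by
  obtain ⟨g, hg⟩ := exists_schwartzMap_smallChar h0 h2
  -- The division by 2π accounts for the kernel exp(−2πi x ξ) in the definition of 𝓕.
  have hF : ∀ v, cosT (smallChar α) v = ((𝓕 g) (v / (2 * Real.pi))).re := fun v => by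
    have hpi := Real.pi_pos.ne'
    rw [SchwartzMap.fourier_coe, Real.fourier_real_eq_integral_exp_smul]
    have hi : Integrable fun ξ : ℝ =>
        Complex.exp (((-2 * Real.pi * ξ * (v / (2 * Real.pi)) : ℝ) : ℂ) * Complex.I) • g ξ := by
      refine (g.integrable (μ := volume)).bdd_mul (c := 1)
        (by fun_prop) (ae_of_all _ fun ξ => ?_)
      rw [Complex.norm_exp_ofReal_mul_I]
    rw [← RCLike.re_eq_complex_re, ← integral_re hi, cosT]
    refine integral_congr_ae (ae_of_all _ fun ξ => ?_)
    have e : -2 * Real.pi * ξ * (v / (2 * Real.pi)) = -(v * ξ) := by field_simp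
    simp only [hg, smul_eq_mul, RCLike.re_eq_complex_re, e, Complex.re_mul_ofReal,
      Complex.exp_ofReal_mul_I_re, Real.cos_neg]
  obtain ⟨C0, -, hC0⟩ := (𝓕 g).decay 0 0
  obtain ⟨C3, -, hC3⟩ := (𝓕 g).decay 3 0
  refine ⟨max C0 ((2 * Real.pi) ^ 3 * C3), fun v => ?_⟩
  set x := v / (2 * Real.pi) with hx
  have hn : cosT (smallChar α) v ≤ ‖(𝓕 g) x‖ := by
    rw [hF]; exact (le_abs_self _).trans (Complex.abs_re_le_norm _)
  have h00 : ‖(𝓕 g) x‖ ≤ C0 := by simpa using hC0 x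
  have h3 : |x| ^ 3 * ‖(𝓕 g) x‖ ≤ C3 := by simpa using hC3 x
  have hW := tailWeight_pos α v
  refine hn.trans ?_
  rcases le_total |v| 1 with h | h
  · have : tailWeight α v = 1 := by simp [tailWeight, max_eq_left h]
    rw [this, mul_one]
    exact h00.trans (le_max_left _ _)
  · have hw : |v| ^ (-3 : ℝ) ≤ tailWeight α v := by
      rw [tailWeight, max_eq_right h]
      exact Real.rpow_le_rpow_of_exponent_le h (by linarith)
    have hv : (0 : ℝ) < |v| ^ 3 := by positivity
    have e : |v| ^ (-3 : ℝ) = (|v| ^ 3)⁻¹ := by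
      rw [Real.rpow_neg (abs_nonneg v), show (3 : ℝ) = ((3 : ℕ) : ℝ) by norm_num,
        Real.rpow_natCast]
    have hpi := Real.pi_pos
    have e2 : |x| ^ 3 = |v| ^ 3 / (2 * Real.pi) ^ 3 := by
      rw [hx, abs_div, abs_of_pos (by positivity : 0 < 2 * Real.pi), div_pow]
    have h5 : ‖(𝓕 g) x‖ ≤ (2 * Real.pi) ^ 3 * C3 * (|v| ^ 3)⁻¹ := by
      rw [← div_eq_mul_inv, le_div_iff₀ hv]
      rw [e2, div_mul_eq_mul_div, div_le_iff₀ (by positivity)] at h3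
      linarith
    refine h5.trans ?_
    rw [← e]
    have hC30 : 0 ≤ C3 := le_trans (by positivity) h3
    exact mul_le_mul (le_max_right _ _) hw (by positivity)
      (le_trans (by positivity) (le_max_right _ _))

/-! ### Nonnegativity of the small-jump density. -/

theorem cosT_gaussian_nonneg {s : ℝ} (hs : 0 < s) (v : ℝ) :
    0 ≤ cosT (fun ξ => Real.exp (-s * ξ ^ 2)) v := by
  have h := fourierIntegral_gaussian (b := (s : ℂ)) (by simpa using hs) (v : ℂ)
  have hi : Integrable fun ξ : ℝ =>
      Complex.exp (Complex.I * v * ξ) * Complex.exp (-(s : ℂ) * (ξ : ℂ) ^ 2) := by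
    have hg : Integrable fun ξ : ℝ => Complex.exp (-(s : ℂ) * (ξ : ℂ) ^ 2) :=
      integrable_cexp_neg_mul_sq (by simpa using hs)
    refine hg.bdd_mul (c := 1) (by fun_prop) (ae_of_all _ fun ξ => ?_)
    rw [show Complex.I * (v : ℂ) * ξ = ((v * ξ : ℝ) : ℂ) * Complex.I by push_cast; ring,
      Complex.norm_exp_ofReal_mul_I]
  have e : cosT (fun ξ => Real.exp (-s * ξ ^ 2)) v =
      (∫ ξ : ℝ, Complex.exp (Complex.I * v * ξ) * Complex.exp (-(s : ℂ) * (ξ : ℂ) ^ 2)).re := by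
    rw [← RCLike.re_eq_complex_re, ← integral_re hi, cosT]
    refine integral_congr_ae (ae_of_all _ fun ξ => ?_)
    simp only [RCLike.re_eq_complex_re]
    rw [show Complex.I * (v : ℂ) * ξ = ((v * ξ : ℝ) : ℂ) * Complex.I by push_cast; ring,
      show -(s : ℂ) * (ξ : ℂ) ^ 2 = ((-s * ξ ^ 2 : ℝ) : ℂ) by push_cast; ring,
      ← Complex.ofReal_exp, Complex.re_mul_ofReal, Complex.exp_ofReal_mul_I_re]
  rw [e, h]
  have e2 : ((Real.pi : ℂ) / s) ^ (1 / 2 : ℂ) * Complex.exp (-(v : ℂ) ^ 2 / (4 * s)) =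
      (((Real.pi / s) ^ (1 / 2 : ℝ) * Real.exp (-v ^ 2 / (4 * s)) : ℝ) : ℂ) := by
    rw [Complex.ofReal_mul, Complex.ofReal_exp,
      Complex.ofReal_cpow (div_nonneg Real.pi_pos.le hs.le)]
    push_cast
    rfl
  rw [e2, Complex.ofReal_re]
  have := div_nonneg Real.pi_pos.le hs.le
  positivity

/-- Compound Poisson factors with a nonnegative symmetric jump density preserve nonnegativity of
the cosine transform. -/
theorem cosT_mul_exp_nonneg {m p : ℝ → ℝ} (hm : Integrable m) (hp : Integrable p)
    (he : ∀ y, p (-y) = p y) (hp0 : ∀ y, 0 ≤ p y) (hnn : ∀ v, 0 ≤ cosT m v) (v : ℝ) :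
    0 ≤ cosT (fun ξ => m ξ * Real.exp (cosT p ξ)) v := by
  have hu : ∀ (n : ℕ) v, 0 ≤ cosT (fun ξ => m ξ * cosT p ξ ^ n) v := fun n => by
    induction n with
    | zero => simpa using hnn
    | succ n ih =>
      intro v
      rw [(cosT_mul_pow_succ hm hp he n).2]
      exact integral_nonneg fun y => mul_nonneg (hp0 y) (ih _)
  exact (hasSum_cosT_mul_exp hm hp he v).nonneg fun n => div_nonneg (hu n v) (Nat.cast_nonneg _)

theorem tendsto_cosT {m : ℕ → ℝ → ℝ} {g b : ℝ → ℝ} (hm : ∀ n, AEStronglyMeasurable (m n))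
    (hb : Integrable b) (hle : ∀ n ξ, |m n ξ| ≤ b ξ)
    (hlim : ∀ ξ, Filter.Tendsto (fun n => m n ξ) Filter.atTop (nhds (g ξ))) (v : ℝ) :
    Filter.Tendsto (fun n => cosT (m n) v) Filter.atTop (nhds (cosT g v)) := by
  refine tendsto_integral_of_dominated_convergence b (fun n => ?_) hb
    (fun n => ae_of_all _ fun ξ => ?_) (ae_of_all _ fun ξ => (hlim ξ).const_mul _)
  · exact (by fun_prop : Measurable fun y : ℝ => Real.cos (v * y)).aestronglyMeasurable.mul (hm n)
  · rw [norm_mul]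
    exact (mul_le_of_le_one_left (norm_nonneg _) (Real.abs_cos_le_one _)).trans (hle n ξ)

/-- The small jump density restricted to jumps larger than `1 / (n + 1)`. -/
def truncJump (α : ℝ) (n : ℕ) (y : ℝ) : ℝ :=
  {y : ℝ | 1 / ((n : ℝ) + 1) < |y|}.indicator (smallJump α) y

theorem measurableSet_truncJump (n : ℕ) : MeasurableSet {y : ℝ | 1 / ((n : ℝ) + 1) < |y|} :=
  measurableSet_lt measurable_const measurable_norm

theorem truncJump_neg (α : ℝ) (n : ℕ) (y : ℝ) : truncJump α n (-y) = truncJump α n y := by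
  simp [truncJump, Set.indicator, smallJump_neg]

theorem truncJump_nonneg {α : ℝ} (h0 : 0 < α) (n : ℕ) (y : ℝ) : 0 ≤ truncJump α n y := by
  refine Set.indicator_nonneg (fun y hy => smallJump_nonneg h0 fun h => ?_) y
  simp only [Set.mem_ofPred_eq, h, abs_zero] at hy
  exact absurd hy (not_lt.2 (by positivity))

theorem integrable_truncJump {α : ℝ} (h0 : 0 < α) (h2 : α < 2) (n : ℕ) :
    Integrable (truncJump α n) := by
  refine ((integrable_sq_mul_smallJump h0 h2).norm.const_mul (((n : ℝ) + 1) ^ 2)).mono'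
    ((measurable_smallJump α).indicator (measurableSet_truncJump n)).aestronglyMeasurable
    (ae_of_all _ fun y => ?_)
  by_cases hy : 1 / ((n : ℝ) + 1) < |y|
  · rw [truncJump, Set.indicator_of_mem (by exact hy), norm_mul, ← mul_assoc, norm_pow, ← mul_pow]
    rw [div_lt_iff₀ (by positivity)] at hy
    refine le_mul_of_one_le_left (norm_nonneg _) (one_le_pow₀ ?_)
    rw [Real.norm_eq_abs]
    linarith
  · rw [truncJump, Set.indicator_of_notMem (by exact hy), norm_zero]
    positivity

/-- The characteristic exponent of the truncated small jumps. -/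
def truncSymbol (α : ℝ) (n : ℕ) (ξ : ℝ) : ℝ := ∫ y, (1 - Real.cos (ξ * y)) * truncJump α n y

theorem truncSymbol_nonneg {α : ℝ} (h0 : 0 < α) (n : ℕ) (ξ : ℝ) : 0 ≤ truncSymbol α n ξ :=
  integral_nonneg fun y =>
    mul_nonneg (by linarith [Real.cos_le_one (ξ * y)]) (truncJump_nonneg h0 n y)

theorem truncSymbol_eq {α : ℝ} (h0 : 0 < α) (h2 : α < 2) (n : ℕ) (ξ : ℝ) :
    truncSymbol α n ξ = (∫ y, truncJump α n y) - cosT (truncJump α n) ξ := by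
  have hT := integrable_truncJump h0 h2 n
  rw [truncSymbol, cosT, ← integral_sub hT (integrable_cos_mul hT ξ)]
  refine integral_congr_ae (ae_of_all _ fun y => ?_)
  simp only
  ring

theorem tendsto_truncSymbol {α : ℝ} (h0 : 0 < α) (h2 : α < 2) (ξ : ℝ) :
    Filter.Tendsto (fun n => truncSymbol α n ξ) Filter.atTop (nhds (smallSymbol α ξ)) := by
  refine tendsto_integral_of_dominated_convergence
    (fun y => ‖(1 - Real.cos (ξ * y)) * smallJump α y‖) (fun n => ?_)
    (integrable_one_sub_cos_mul_smallJump h0 h2 ξ).norm (fun n => ae_of_all _ fun y => ?_)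
    (ae_of_all _ fun y => ?_)
  · exact ((by fun_prop : Measurable fun y : ℝ => 1 - Real.cos (ξ * y)).mul
      ((measurable_smallJump α).indicator (measurableSet_truncJump n))).aestronglyMeasurable
  · rw [norm_mul, norm_mul]
    exact mul_le_mul_of_nonneg_left (norm_indicator_le_norm_self _ _) (norm_nonneg _)
  · rcases eq_or_ne y 0 with rfl | hy
    · simp
    · refine Filter.Tendsto.const_mul _ (tendsto_const_nhds.congr' ?_)
      have ht := tendsto_one_div_add_atTop_nhds_zero_nat (𝕜 := ℝ)
      filter_upwards [ht.eventually (gt_mem_nhds (abs_pos.2 hy))] with n hn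
      rw [truncJump, Set.indicator_of_mem (by exact hn)]

theorem integrable_gaussian {s : ℝ} (hs : 0 < s) :
    Integrable fun ξ : ℝ => Real.exp (-s * ξ ^ 2) := integrable_exp_neg_mul_sq hs

theorem cosT_smallChar_nonneg {α : ℝ} (h0 : 0 < α) (h2 : α < 2) (v : ℝ) :
    0 ≤ cosT (smallChar α) v := by
  have hk := jumpConst_pos h0 h2
  have hsc : Continuous (smallChar α) := by
    obtain ⟨g, hg⟩ := exists_schwartzMap_smallChar h0 h2
    have : smallChar α = fun ξ => (g ξ).re := by funext ξ; simp [hg]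
    rw [this]
    exact Complex.continuous_re.comp g.continuous
  -- Truncation away from 0 makes the jump density integrable, so the jumps are compound Poisson.
  -- Their characteristic function does not decay, so a Gaussian factor is inserted to make it
  -- integrable; the truncation is removed first, then the Gaussian.
  have htrunc : ∀ s : ℝ, 0 < s → ∀ n : ℕ, 0 ≤ cosT (fun ξ => Real.exp (-s * ξ ^ 2) *
      Real.exp (-(jumpConst α * truncSymbol α n ξ))) v := fun s hs n => by
    have hT := integrable_truncJump h0 h2 n
    have h := cosT_mul_exp_nonneg (integrable_gaussian hs) (hT.const_mul (jumpConst α))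
      (fun y => by rw [truncJump_neg]) (fun y => mul_nonneg hk.le (truncJump_nonneg h0 n y))
      (cosT_gaussian_nonneg hs) v
    have e : cosT (fun ξ => Real.exp (-s * ξ ^ 2) *
        Real.exp (-(jumpConst α * truncSymbol α n ξ))) v =
        Real.exp (-(jumpConst α * ∫ y, truncJump α n y)) * cosT (fun ξ => Real.exp (-s * ξ ^ 2) *
          Real.exp (cosT (fun y => jumpConst α * truncJump α n y) ξ)) v := by
      have e1 : ∀ ξ, cosT (fun y => jumpConst α * truncJump α n y) ξ =
          jumpConst α * cosT (truncJump α n) ξ := fun ξ => by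
        simp only [cosT, mul_left_comm _ (jumpConst α), integral_const_mul]
      rw [cosT, cosT, ← integral_const_mul]
      refine integral_congr_ae (ae_of_all _ fun ξ => ?_)
      simp only [e1, truncSymbol_eq h0 h2]
      rw [show -(jumpConst α * ((∫ y, truncJump α n y) - cosT (truncJump α n) ξ)) =
        -(jumpConst α * ∫ y, truncJump α n y) + jumpConst α * cosT (truncJump α n) ξ by ring,
        Real.exp_add]
      ring
    rw [e]
    exact mul_nonneg (Real.exp_pos _).le h
  have hgauss : ∀ s : ℝ, 0 < s → 0 ≤ cosT (fun ξ => Real.exp (-s * ξ ^ 2) * smallChar α ξ) v :=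
    fun s hs => by
      refine ge_of_tendsto' (tendsto_cosT (m := fun n ξ => Real.exp (-s * ξ ^ 2) *
        Real.exp (-(jumpConst α * truncSymbol α n ξ))) (fun n => ?_) (integrable_gaussian hs)
        (fun n ξ => ?_) (fun ξ => ?_) v) (htrunc s hs)
      · have : Continuous (truncSymbol α n) := by
          have e : truncSymbol α n = fun ξ =>
              (∫ y, truncJump α n y) - cosT (truncJump α n) ξ :=
            funext fun ξ => truncSymbol_eq h0 h2 n ξ
          rw [e]
          exact continuous_const.sub (continuous_cosT (integrable_truncJump h0 h2 n))
        exact (by fun_prop : Continuous fun ξ : ℝ => Real.exp (-s * ξ ^ 2) *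
          Real.exp (-(jumpConst α * truncSymbol α n ξ))).aestronglyMeasurable
      · rw [abs_of_pos (by positivity)]
        refine mul_le_of_le_one_right (Real.exp_pos _).le (Real.exp_le_one_iff.2 ?_)
        have := mul_nonneg hk.le (truncSymbol_nonneg h0 n ξ)
        linarith
      · exact (((tendsto_truncSymbol h0 h2 ξ).const_mul _).neg.rexp).const_mul _
  refine ge_of_tendsto' (tendsto_cosT (m := fun (n : ℕ) ξ =>
      Real.exp (-(1 / ((n : ℝ) + 1)) * ξ ^ 2) * smallChar α ξ) (fun n => ?_)
      (integrable_smallChar h0 h2) (fun n ξ => ?_) (fun ξ => ?_) v)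
      (fun n => hgauss _ (by positivity))
  · exact (by fun_prop : Continuous fun ξ : ℝ =>
      Real.exp (-(1 / ((n : ℝ) + 1)) * ξ ^ 2) * smallChar α ξ).aestronglyMeasurable
  · have hp : 0 < smallChar α ξ := Real.exp_pos _
    rw [abs_of_pos (by positivity)]
    refine mul_le_of_le_one_left hp.le (Real.exp_le_one_iff.2 ?_)
    have : 0 ≤ 1 / ((n : ℝ) + 1) * ξ ^ 2 := by positivity
    linarith
  · have ht := ((tendsto_one_div_add_atTop_nhds_zero_nat (𝕜 := ℝ)).neg.mul_const
      (ξ ^ 2)).rexp.mul_const (smallChar α ξ)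
    simpa using ht

theorem cosT_smallChar_zero_pos {α : ℝ} (h0 : 0 < α) (h2 : α < 2) : 0 < cosT (smallChar α) 0 := by
  have e : cosT (smallChar α) 0 = ∫ ξ, smallChar α ξ := by simp [cosT]
  have hs : Function.support (smallChar α) = Set.univ := by
    ext ξ
    simp [smallChar, Real.exp_ne_zero]
  rw [e, integral_pos_iff_support_of_nonneg (f := smallChar α)
    (fun ξ => (Real.exp_pos _).le) (integrable_smallChar h0 h2), hs]
  simp

/-! ### Two-sided bounds for the stable density. -/

theorem mu_eq_cosT {α : ℝ} (h0 : 0 < α) (h2 : α < 2) (v : ℝ) :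
    mu α v = 1 / (2 * Real.pi) * cosT (fun ξ => Real.exp (-(|ξ| ^ α / α))) v := by
  have hm : Integrable fun ξ : ℝ => Real.exp (-(|ξ| ^ α / α)) := by
    have hp := (integrable_tailWeight h0).const_mul (jumpConst α)
    have := ((integrable_smallChar h0 h2).bdd_mul
      (f := fun ξ => Real.exp (cosT (fun y => jumpConst α * tailWeight α y) ξ))
      (c := Real.exp (∫ y, |jumpConst α * tailWeight α y|))
      (continuous_cosT hp).rexp.aestronglyMeasurable (ae_of_all _ fun ξ => by
        rw [Real.norm_of_nonneg (Real.exp_pos _).le, Real.exp_le_exp]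
        exact (le_abs_self _).trans (abs_cosT_le hp ξ))).const_mul
      (Real.exp (-(jumpConst α * ∫ y, tailWeight α y)))
    refine this.congr (ae_of_all _ fun ξ => ?_)
    simp only
    rw [smallChar_mul_exp h0 h2, mul_comm (smallChar α ξ)]
  have e : ∀ ξ : ℝ, Complex.exp (Complex.I * (v : ℂ) * (ξ : ℂ) - ((|ξ| ^ α / α : ℝ) : ℂ)) =
      Complex.exp ((v * ξ : ℝ) * Complex.I) * (Real.exp (-(|ξ| ^ α / α)) : ℝ) := fun ξ => by
    rw [Complex.ofReal_exp, ← Complex.exp_add]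
    congr 1
    push_cast
    ring
  have hi : Integrable fun ξ : ℝ =>
      Complex.exp ((v * ξ : ℝ) * Complex.I) * (Real.exp (-(|ξ| ^ α / α)) : ℝ) := by
    refine hm.ofReal.bdd_mul (c := 1) (by fun_prop) (ae_of_all _ fun ξ => ?_)
    rw [Complex.norm_exp_ofReal_mul_I]
  rw [mu, muC]
  simp only [e]
  rw [show (1 / (2 * (Real.pi : ℂ))) = ((1 / (2 * Real.pi) : ℝ) : ℂ) by push_cast; rfl,
    Complex.re_ofReal_mul, ← RCLike.re_eq_complex_re, ← integral_re hi, cosT]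
  congr 1
  refine integral_congr_ae (ae_of_all _ fun ξ => ?_)
  simp only [RCLike.re_eq_complex_re, Complex.re_mul_ofReal, Complex.exp_ofReal_mul_I_re]

/-- Two-sided bounds for the symmetric stable density. -/
theorem mu_bounds {α : ℝ} (h0 : 0 < α) (h2 : α < 2) :
    ∃ c C : ℝ, 0 < c ∧ ∀ v, c * tailWeight α v ≤ mu α v ∧ mu α v ≤ C * tailWeight α v := by
  obtain ⟨D, hD⟩ := cosT_smallChar_le h0 h2
  obtain ⟨c, C, hc, H⟩ := cosT_mul_exp_bounds h0 (integrable_smallChar h0 h2)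
    (jumpConst_pos h0 h2) (cosT_smallChar_nonneg h0 h2) (cosT_smallChar_zero_pos h0 h2) hD
  set E := 1 / (2 * Real.pi) * Real.exp (-(jumpConst α * ∫ y, tailWeight α y)) with hE
  have hE0 : 0 < E := by have := Real.pi_pos; positivity
  have e : ∀ v, mu α v = E * cosT (fun ξ => smallChar α ξ *
      Real.exp (cosT (fun y => jumpConst α * tailWeight α y) ξ)) v := fun v => by
    rw [mu_eq_cosT h0 h2, hE, mul_assoc]
    congr 1
    rw [cosT, cosT, ← integral_const_mul]
    refine integral_congr_ae (ae_of_all _ fun ξ => ?_)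
    simp only [smallChar_mul_exp h0 h2]
    ring
  refine ⟨E * c, E * C, mul_pos hE0 hc, fun v => ?_⟩
  rw [e, mul_assoc E c, mul_assoc E C]
  exact ⟨mul_le_mul_of_nonneg_left (H v).1 hE0.le, mul_le_mul_of_nonneg_left (H v).2 hE0.le⟩

/-! ### Abstract Poincaré and interpolation inequalities for a discrete Dirichlet form. -/

/-- The summand of the discrete Dirichlet form with equilibrium `m` and jump rates `b`. -/
def dirTerm (m b f : ℤ → ℝ) (p : ℤ × ℤ) : ℝ :=
  b p.2 * (f p.1 / m p.1 - f (p.1 + p.2) / m (p.1 + p.2)) ^ 2 * m p.1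

/-- The shear `(j, k) ↦ (j, j + k)` of `ℤ × ℤ`. -/
def shearEquiv : ℤ × ℤ ≃ ℤ × ℤ where
  toFun p := (p.1, p.1 + p.2)
  invFun p := (p.1, p.2 - p.1)
  left_inv p := by simp
  right_inv p := by simp

section

variable {m b f : ℤ → ℝ}

theorem dirTerm_nonneg (hm : ∀ j, 0 < m j) (hb : ∀ k, 0 ≤ b k) (p : ℤ × ℤ) :
    0 ≤ dirTerm m b f p :=
  mul_nonneg (mul_nonneg (hb _) (sq_nonneg _)) (hm _).le

theorem summable_of_sq_div (hm : ∀ j, 0 < m j) (hms : Summable m)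
    (hf : Summable fun j => f j ^ 2 / m j) : Summable f := by
  refine Summable.of_norm_bounded (hf.add hms) fun j => ?_
  have h := hm j
  have e : f j ^ 2 / m j + m j - |f j| = ((|f j| - m j) ^ 2 + |f j| * m j) / m j := by
    rw [← sq_abs]
    field_simp
    ring
  have : 0 ≤ f j ^ 2 / m j + m j - |f j| := by rw [e]; positivity
  rw [Real.norm_eq_abs]
  linarith

theorem summable_prod_mul {φ ψ : ℤ → ℝ} (hφ : Summable φ) (hψ : Summable ψ)
    (hφ0 : ∀ j, 0 ≤ φ j) (hψ0 : ∀ j, 0 ≤ ψ j) : Summable fun p : ℤ × ℤ => φ p.1 * ψ p.2 :=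
  hφ.mul_of_nonneg hψ hφ0 hψ0

/-- After expanding the square, the part in f_j is a product of summable sequences. In the part in
f_l, l = j + k, the mass m_j sits at the wrong point; `hbm` exchanges b_k m_{l−k} for m_l (w_k +
w_{l−k}), and a shear of ℤ² gives products again. -/
theorem summable_dirTerm (hm : ∀ j, 0 < m j) (hb : ∀ k, 0 ≤ b k) {w : ℤ → ℝ} (hw : Summable w)
    (hw0 : ∀ k, 0 ≤ w k) (hbw : ∀ k, b k ≤ w k)
    (hbm : ∀ k l, b k * m (l - k) ≤ m l * (w k + w (l - k)))
    (hf : Summable fun j => f j ^ 2 / m j) : Summable (dirTerm m b f) := by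
  have hφ0 : ∀ j, 0 ≤ f j ^ 2 / m j := fun j => div_nonneg (sq_nonneg _) (hm j).le
  have s1 : Summable fun p : ℤ × ℤ => f p.1 ^ 2 / m p.1 * w p.2 :=
    summable_prod_mul hf hw hφ0 hw0
  have s2 : Summable fun p : ℤ × ℤ => w p.1 * (f (p.1 + p.2) ^ 2 / m (p.1 + p.2)) :=
    shearEquiv.summable_iff.2 (summable_prod_mul hw hf hw0 hφ0)
  have s3 : Summable fun p : ℤ × ℤ => f (p.1 + p.2) ^ 2 / m (p.1 + p.2) * w p.2 := by
    refine ((Equiv.prodComm ℤ ℤ).summable_iff.2 s2).congr fun p => ?_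
    simp only [Function.comp, Equiv.prodComm_apply, Prod.fst_swap, Prod.snd_swap, add_comm p.2]
    ring
  refine Summable.of_nonneg_of_le (dirTerm_nonneg hm hb) (fun p => ?_)
    ((s1.add (s3.add s2)).mul_left 2)
  obtain ⟨j, k⟩ := p
  simp only [dirTerm]
  set l := j + k with hl
  have hj := hm j
  have hml := hm l
  have e1 : b k * (f j / m j) ^ 2 * m j ≤ f j ^ 2 / m j * w k := by
    have e : b k * (f j / m j) ^ 2 * m j = f j ^ 2 / m j * b k := by field_simp
    rw [e]
    exact mul_le_mul_of_nonneg_left (hbw k) (hφ0 j)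
  have e2 : b k * (f l / m l) ^ 2 * m j ≤ f l ^ 2 / m l * (w k + w j) := by
    have h1 := hbm k l
    rw [show l - k = j by omega] at h1
    have e : b k * (f l / m l) ^ 2 * m j = (b k * m j) * (f l / m l) ^ 2 := by ring
    rw [e]
    refine (mul_le_mul_of_nonneg_right h1 (sq_nonneg _)).trans_eq ?_
    field_simp
  have e3 : b k * (f j / m j - f l / m l) ^ 2 * m j ≤
      2 * (b k * (f j / m j) ^ 2 * m j + b k * (f l / m l) ^ 2 * m j) := by
    have h0 : 0 ≤ b k * m j := mul_nonneg (hb k) hj.le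
    have := mul_nonneg h0 (sq_nonneg (f j / m j + f l / m l))
    nlinarith
  linarith

/-- Poincaré inequality for the discrete Dirichlet form. -/
theorem tsum_sq_div_le_dirTerm (hm : ∀ j, 0 < m j) (hms : Summable m)
    (hbe : ∀ k, b (-k) = b k) {A : ℝ}
    (hA : ∀ j l, j ≠ l → m j * m l ≤ A * b (l - j) * (m j + m l))
    (hf : Summable fun j => f j ^ 2 / m j) (hd : Summable (dirTerm m b f)) :
    (∑' j, m j) * (∑' j, f j ^ 2 / m j) ≤ (∑' j, f j) ^ 2 + A * ∑' p, dirTerm m b f p := by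
  have hφ0 : ∀ j, 0 ≤ f j ^ 2 / m j := fun j => div_nonneg (sq_nonneg _) (hm j).le
  have hfs := summable_of_sq_div hm hms hf
  have p1 := summable_prod_mul hf hms hφ0 fun j => (hm j).le
  have p2 := summable_prod_mul hms hf (fun j => (hm j).le) hφ0
  have p3 : Summable fun p : ℤ × ℤ => f p.1 * f p.2 := summable_mul_of_summable_norm hfs.norm hfs.norm
  have t1 := hf.tsum_mul_tsum hms p1
  have t2 := hms.tsum_mul_tsum hf p2
  have t3 := hfs.tsum_mul_tsum hfs p3
  have d1 : HasSum (fun p : ℤ × ℤ => dirTerm m b f (p.1, p.2 - p.1)) (∑' p, dirTerm m b f p) :=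
    shearEquiv.symm.hasSum_iff.2 hd.hasSum
  have d2 : HasSum (fun p : ℤ × ℤ => dirTerm m b f (p.2, p.1 - p.2)) (∑' p, dirTerm m b f p) :=
    (Equiv.prodComm ℤ ℤ).hasSum_iff.2 d1
  -- The left side sums m_j m_l (f_j/m_j − f_l/m_l)² over all pairs. The factor m_j + m_l in `hA`
  -- produces the Dirichlet sum once for each ordering of a pair, so a factor 2 cancels on both
  -- sides.
  have hL := (p1.hasSum.add p2.hasSum).sub (p3.hasSum.mul_left 2)
  have key := hasSum_le (fun p : ℤ × ℤ => ?_) hL ((d1.add d2).mul_left A)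
  · rw [← t1, ← t2, ← t3] at key
    nlinarith
  · obtain ⟨j, l⟩ := p
    have hj := hm j
    have hl := hm l
    have e : f j ^ 2 / m j * m l + m j * (f l ^ 2 / m l) - 2 * (f j * f l) =
        (m j * m l) * (f j / m j - f l / m l) ^ 2 := by
      field_simp
      ring
    simp only [dirTerm]
    rw [e, add_sub_cancel, add_sub_cancel, ← neg_sub l j, hbe]
    rcases eq_or_ne j l with rfl | hne
    · simp
    · refine (mul_le_mul_of_nonneg_right (hA j l hne) (sq_nonneg _)).trans_eq ?_
      ring

end

/-- Centred differences telescope with step two, so two boundary values survive at each end. -/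
theorem sum_D_eq {h : ℝ} (f : ℤ → ℝ) (j : ℤ) (R : ℕ) :
    ∑ k ∈ Finset.range R, D h f (j + (k + 1)) =
      (f (j + R + 1) + f (j + R) - f (j + 1) - f j) / (2 * h) := by
  induction R with
  | zero => simp
  | succ R ih =>
    rw [Finset.sum_range_succ, ih, D]
    push_cast
    rw [show j + ((R : ℤ) + 1) + 1 = j + (R + 1) + 1 by ring,
      show j + ((R : ℤ) + 1) - 1 = j + R by ring, show j + (R : ℤ) + 1 = j + (R + 1) by ring]
    ring

theorem sq_sum_four_le (a b c d : ℝ) :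
    (a + b - c - d) ^ 2 ≤ 4 * (a ^ 2 + b ^ 2 + c ^ 2 + d ^ 2) := by
  linarith [sq_nonneg (a - b), sq_nonneg (a + c), sq_nonneg (a + d), sq_nonneg (b + c),
    sq_nonneg (b + d), sq_nonneg (c - d)]

section

variable {m b f : ℤ → ℝ}

/-- Pointwise comparison of a centred difference with its weighted average over a block of
length `R`, which telescopes. -/
theorem sq_D_div_le (hm : ∀ j, 0 < m j) {h L : ℝ} (hh : 0 < h) (hL : 0 < L) {R : ℕ} (hR : 1 ≤ R)
    (hcomp : ∀ j i : ℤ, 0 ≤ i → i ≤ R + 1 → m (j + i) ≤ L * m j ∧ m j ≤ L * m (j + i)) (j : ℤ) :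
    D h f j ^ 2 / m j ≤
      2 * L ^ 4 / R * (∑ k ∈ Finset.range R,
        (D h f j / m j - D h f (j + (k + 1)) / m (j + (k + 1))) ^ 2 * m j) +
      2 * L ^ 3 / (R ^ 2 * h ^ 2) * (f (j + (R + 1)) ^ 2 / m (j + (R + 1)) +
        f (j + R) ^ 2 / m (j + R) + f (j + 1) ^ 2 / m (j + 1) + f (j + 0) ^ 2 / m (j + 0)) := by
  have hj := hm j
  have hR' : (0 : ℝ) < R := by exact_mod_cast hR
  set G : ℤ → ℝ := fun j => D h f j / m j with hG
  have hgm : ∀ i, D h f i = m i * G i := fun i => by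
    rw [hG]; field_simp [(hm i).ne']
  set S := ∑ k ∈ Finset.range R, m (j + ((k : ℤ) + 1)) with hS
  set Δ := ∑ k ∈ Finset.range R, (G j - G (j + ((k : ℤ) + 1))) ^ 2 with hΔ
  have hmem : ∀ k ∈ Finset.range R, m (j + ((k : ℤ) + 1)) ≤ L * m j ∧
      m j ≤ L * m (j + ((k : ℤ) + 1)) := fun k hk => by
    have := Finset.mem_range.1 hk
    exact hcomp j _ (by omega) (by omega)
  have hSlow : R * m j ≤ L * S := by
    rw [hS, Finset.mul_sum]
    have := Finset.sum_le_sum fun k hk => (hmem k hk).2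
    simpa using this
  -- Add and subtract G at the other points of the block: the weights m turn the average of G back
  -- into a sum of values of D f, which telescopes.
  have hsplit : G j * S = (∑ k ∈ Finset.range R, m (j + ((k : ℤ) + 1)) *
      (G j - G (j + ((k : ℤ) + 1)))) +
      (f (j + R + 1) + f (j + R) - f (j + 1) - f j) / (2 * h) := by
    rw [← sum_D_eq f j R, ← Finset.sum_add_distrib, hS, Finset.mul_sum]
    refine Finset.sum_congr rfl fun k _ => ?_
    rw [hgm]
    ring
  have h1 : (∑ k ∈ Finset.range R, m (j + ((k : ℤ) + 1)) * (G j - G (j + ((k : ℤ) + 1)))) ^ 2 ≤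
      R * ((L * m j) ^ 2 * Δ) := by
    refine sq_sum_le_card_mul_sum_sq.trans ?_
    rw [Finset.card_range, hΔ]
    refine mul_le_mul_of_nonneg_left ?_ hR'.le
    rw [Finset.mul_sum]
    refine Finset.sum_le_sum fun k hk => ?_
    rw [mul_pow]
    exact mul_le_mul_of_nonneg_right (pow_le_pow_left₀ (hm _).le (hmem k hk).1 2) (sq_nonneg _)
  set Φ := f (j + (R + 1)) ^ 2 / m (j + (R + 1)) +
        f (j + R) ^ 2 / m (j + R) + f (j + 1) ^ 2 / m (j + 1) + f (j + 0) ^ 2 / m (j + 0) with hΦ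
  have hf : ∀ i : ℤ, 0 ≤ i → i ≤ R + 1 → f (j + i) ^ 2 ≤ L * m j * (f (j + i) ^ 2 / m (j + i)) :=
    fun i h0 h1 => by
      have := (hcomp j i h0 h1).1
      have hp := hm (j + i)
      rw [mul_div_assoc', le_div_iff₀ hp, mul_comm (L * m j)]
      exact mul_le_mul_of_nonneg_left this (sq_nonneg _)
  have h2 : ((f (j + R + 1) + f (j + R) - f (j + 1) - f j) / (2 * h)) ^ 2 ≤
      L * m j * Φ / h ^ 2 := by
    rw [div_pow, mul_pow]
    have e := sq_sum_four_le (f (j + R + 1)) (f (j + R)) (f (j + 1)) (f j)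
    have f1 := hf (R + 1) (by omega) (by omega)
    have f2 := hf R (by omega) (by omega)
    have f3 := hf 1 (by omega) (by omega)
    have f4 := hf 0 (by omega) (by omega)
    rw [add_assoc j] at e ⊢
    rw [add_zero] at f4
    rw [div_le_div_iff₀ (by positivity) (by positivity)]
    have : (f (j + ((R : ℤ) + 1)) + f (j + R) - f (j + 1) - f j) ^ 2 ≤ 4 * (L * m j * Φ) := by
      rw [hΦ, add_zero]
      linarith
    linarith [mul_le_mul_of_nonneg_right this (sq_nonneg h)]
  have h3 : (G j * S) ^ 2 ≤ 2 * (R * ((L * m j) ^ 2 * Δ)) + 2 * (L * m j * Φ / h ^ 2) := by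
    rw [hsplit]
    refine (add_sq_le).trans ?_
    linarith
  have h4 : (R * m j) ^ 2 * G j ^ 2 ≤ L ^ 2 * (G j * S) ^ 2 := by
    have := pow_le_pow_left₀ (by positivity) hSlow 2
    have := mul_le_mul_of_nonneg_right this (sq_nonneg (G j))
    calc _ ≤ _ := this
      _ = _ := by ring
  have h5 : (R * m j) ^ 2 * G j ^ 2 ≤
      L ^ 2 * (2 * (R * ((L * m j) ^ 2 * Δ)) + 2 * (L * m j * Φ / h ^ 2)) :=
    h4.trans (mul_le_mul_of_nonneg_left h3 (sq_nonneg L))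
  have e1 : D h f j ^ 2 / m j = (R * m j) ^ 2 * G j ^ 2 / (R ^ 2 * m j) := by
    rw [hgm]
    field_simp
  have e2 : 2 * L ^ 4 / R * (∑ k ∈ Finset.range R,
        (D h f j / m j - D h f (j + (k + 1)) / m (j + (k + 1))) ^ 2 * m j) +
      2 * L ^ 3 / (R ^ 2 * h ^ 2) * Φ =
      L ^ 2 * (2 * (R * ((L * m j) ^ 2 * Δ)) + 2 * (L * m j * Φ / h ^ 2)) / (R ^ 2 * m j) := by
    rw [← Finset.sum_mul, ← hΔ]
    field_simp
  rw [e1, e2]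
  exact div_le_div_of_nonneg_right h5 (by positivity)

/-- Interpolation inequality for the centred difference. -/
theorem tsum_sq_D_div_le (hm : ∀ j, 0 < m j) (hb : ∀ k, 0 ≤ b k) {h L B : ℝ} (hh : 0 < h)
    (hL : 0 < L) (hB : 0 < B) {R : ℕ} (hR : 1 ≤ R)
    (hcomp : ∀ j i : ℤ, 0 ≤ i → i ≤ R + 1 → m (j + i) ≤ L * m j ∧ m j ≤ L * m (j + i))
    (hbB : ∀ k : ℤ, 1 ≤ k → k ≤ R → B ≤ b k) (hf : Summable fun j => f j ^ 2 / m j)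
    (hg : Summable fun j => D h f j ^ 2 / m j) (hd : Summable (dirTerm m b (D h f))) :
    ∑' j, D h f j ^ 2 / m j ≤ 2 * L ^ 4 / (R * B) * ∑' p, dirTerm m b (D h f) p +
      8 * L ^ 3 / (R * h) ^ 2 * ∑' j, f j ^ 2 / m j := by
  have hR' : (0 : ℝ) < R := by exact_mod_cast hR
  have hdn := dirTerm_nonneg (f := D h f) hm hb
  have hrow := (summable_prod_of_nonneg hdn).1 hd
  have hpt : ∀ j, ∑ k ∈ Finset.range R,
      (D h f j / m j - D h f (j + (k + 1)) / m (j + (k + 1))) ^ 2 * m j ≤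
      B⁻¹ * ∑' k, dirTerm m b (D h f) (j, k) := fun j => by
    have hinj : Function.Injective fun k : ℕ => (k : ℤ) + 1 := fun a b h => by
      simpa using h
    have h1 := (hrow.1 j).sum_le_tsum ((Finset.range R).map ⟨_, hinj⟩) fun k _ => hdn (j, k)
    rw [Finset.sum_map] at h1
    refine le_trans ?_ (mul_le_mul_of_nonneg_left h1 (inv_nonneg.2 hB.le))
    rw [Finset.mul_sum]
    refine Finset.sum_le_sum fun k hk => ?_
    have hk' := Finset.mem_range.1 hk
    have h2 := hbB ((k : ℤ) + 1) (by omega) (by omega)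
    simp only [dirTerm, Function.Embedding.coeFn_mk]
    rw [le_inv_mul_iff₀ hB, mul_assoc]
    exact mul_le_mul_of_nonneg_right h2 (mul_nonneg (sq_nonneg _) (hm j).le)
  have hφ : ∀ i : ℤ, HasSum (fun j => f (j + i) ^ 2 / m (j + i)) (∑' j, f j ^ 2 / m j) := fun i =>
    (Equiv.addRight i).hasSum_iff.2 hf.hasSum
  have hrows : HasSum (fun j => ∑' k, dirTerm m b (D h f) (j, k)) (∑' p, dirTerm m b (D h f) p) := by
    rw [hd.tsum_prod]
    exact hrow.2.hasSum
  have hR1 := (hrows.mul_left B⁻¹).mul_left (2 * L ^ 4 / R)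
  -- Each boundary term is a translate of f² / m with the same sum, which turns the constant 2 L³
  -- into 8 L³.
  have hR2 := ((((hφ (R + 1)).add (hφ R)).add (hφ 1)).add (hφ 0)).mul_left
    (2 * L ^ 3 / (R ^ 2 * h ^ 2))
  refine (hasSum_le (fun j => ?_) hg.hasSum (hR1.add hR2)).trans_eq ?_
  · refine (sq_D_div_le hm hh hL hR hcomp j).trans ?_
    gcongr
    exact hpt j
  · field_simp
    ring

theorem summable_sq_D_div (hm : ∀ j, 0 < m j) {h L : ℝ} (hh : 0 < h)
    (hcomp : ∀ j, m (j + 1) ≤ L * m j ∧ m (j - 1) ≤ L * m j)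
    (hf : Summable fun j => f j ^ 2 / m j) :
    (Summable fun j => D h f j ^ 2 / m j) ∧
      ∑' j, D h f j ^ 2 / m j ≤ L / h ^ 2 * ∑' j, f j ^ 2 / m j := by
  have hφ : ∀ i : ℤ, HasSum (fun j => f (j + i) ^ 2 / m (j + i)) (∑' j, f j ^ 2 / m j) := fun i =>
    (Equiv.addRight i).hasSum_iff.2 hf.hasSum
  have hS := ((hφ 1).add (hφ (-1))).mul_left (L / (2 * h ^ 2))
  have hle : ∀ j, D h f j ^ 2 / m j ≤ L / (2 * h ^ 2) *
      (f (j + 1) ^ 2 / m (j + 1) + f (j + -1) ^ 2 / m (j + -1)) := fun j => by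
    have hj := hm j
    have a1 : f (j + 1) ^ 2 ≤ L * m j * (f (j + 1) ^ 2 / m (j + 1)) := by
      rw [mul_div_assoc', le_div_iff₀ (hm _), mul_comm (L * m j)]
      exact mul_le_mul_of_nonneg_left (hcomp j).1 (sq_nonneg _)
    have a2 : f (j - 1) ^ 2 ≤ L * m j * (f (j - 1) ^ 2 / m (j - 1)) := by
      rw [mul_div_assoc', le_div_iff₀ (hm _), mul_comm (L * m j)]
      exact mul_le_mul_of_nonneg_left (hcomp j).2 (sq_nonneg _)
    rw [← sub_eq_add_neg, D, div_pow, div_div, div_le_iff₀ (by positivity)]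
    have e : L / (2 * h ^ 2) * (f (j + 1) ^ 2 / m (j + 1) + f (j - 1) ^ 2 / m (j - 1)) *
        ((2 * h) ^ 2 * m j) = 2 * (L * m j * (f (j + 1) ^ 2 / m (j + 1)) +
          L * m j * (f (j - 1) ^ 2 / m (j - 1))) := by
      field_simp
    rw [e]
    linarith [sq_nonneg (f (j + 1) + f (j - 1))]
  have hs : Summable fun j => D h f j ^ 2 / m j :=
    Summable.of_nonneg_of_le (fun j => div_nonneg (sq_nonneg _) (hm j).le) hle hS.summable
  refine ⟨hs, (hasSum_le hle hs.hasSum hS).trans_eq ?_⟩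
  field_simp
  ring

end

/-! ### Inequalities for the discrete equilibrium, uniform in the mesh size. -/

section

variable {α : ℝ}

theorem tailWeight_le_rpow (h0 : 0 < α) {x : ℝ} (hx : x ≠ 0) : tailWeight α x ≤ |x| ^ (-1 - α) :=
  Real.rpow_le_rpow_of_nonpos (abs_pos.2 hx) (le_max_right _ _) (by linarith)

theorem summable_tailWeight_int (h0 : 0 < α) : Summable fun j : ℤ => tailWeight α j := by
  have h := Real.summable_abs_int_rpow (b := 1 + α) (by linarith)
  refine Summable.of_norm_bounded_eventually h ?_
  filter_upwards [(Set.finite_singleton (0 : ℤ)).compl_mem_cofinite] with j hj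
  have hj0 : (j : ℝ) ≠ 0 := by exact_mod_cast hj
  rw [Real.norm_of_nonneg (tailWeight_pos α _).le, show -(1 + α) = -1 - α by ring]
  exact tailWeight_le_rpow h0 hj0

/-- The discrete equilibrium is comparable to `tailWeight`. -/
theorem exists_M_bounds (h0 : 0 < α) (h2 : α < 2) : ∃ c C : ℝ, 0 < c ∧ 0 < C ∧ ∀ (h : ℝ) (j : ℤ),
    c * tailWeight α (j * h) ≤ M α h j ∧ M α h j ≤ C * tailWeight α (j * h) := by
  obtain ⟨c, C, hc, H⟩ := mu_bounds h0 h2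
  refine ⟨c, C, hc, ?_, fun h j => H _⟩
  have h1 := (H 0).1.trans (H 0).2
  have h3 := tailWeight_pos α 0
  by_contra h
  nlinarith

/-- The constant blows up as h → 0. It serves only qualitative summability, never the uniform
estimates. -/
theorem tailWeight_mul_step_le (h0 : 0 < α) {h : ℝ} (hh : 0 < h) (h1 : h < 1) (x : ℝ) :
    tailWeight α (x * h) ≤ (1 / h) ^ (1 + α) * tailWeight α x := by
  refine tailWeight_le_of_abs_le h0 (by rw [le_div_iff₀ hh]; linarith) ?_
  rw [abs_mul, abs_of_pos hh]
  field_simp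
  exact le_rfl

theorem tailWeight_le_mul_step (h0 : 0 < α) {h : ℝ} (hh : 0 < h) (h1 : h < 1) (x : ℝ) :
    tailWeight α x ≤ tailWeight α (x * h) := by
  have := tailWeight_le_of_abs_le h0 (K := 1) (u := x) (v := x * h) le_rfl (by
    rw [abs_mul, abs_of_pos hh, one_mul]
    exact mul_le_of_le_one_right (abs_nonneg _) h1.le)
  simpa using this

theorem beta_nonneg (h0 : 0 < α) (h2 : α < 2) {h : ℝ} (hh : 0 < h) (k : ℤ) : 0 ≤ beta α h k := by
  obtain ⟨c, C, hc, H⟩ := beta_bounds h0 h2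
  rcases eq_or_ne k 0 with rfl | hk
  · rw [beta_zero]
  · exact le_trans (by positivity) (H h hh k hk).1

theorem M_pos (h0 : 0 < α) (h2 : α < 2) (h : ℝ) (j : ℤ) : 0 < M α h j := by
  obtain ⟨c, C, hc, -, H⟩ := exists_M_bounds h0 h2
  exact lt_of_lt_of_le (mul_pos hc (tailWeight_pos _ _)) (H h j).1

theorem summable_M (h0 : 0 < α) (h2 : α < 2) {h : ℝ} (hh : 0 < h) (h1 : h < 1) :
    Summable (M α h) := by
  obtain ⟨c, C, hc, hC, H⟩ := exists_M_bounds h0 h2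
  refine Summable.of_nonneg_of_le (fun j => (M_pos h0 h2 h j).le) (fun j => ?_)
    (((summable_tailWeight_int h0).mul_left ((1 / h) ^ (1 + α))).mul_left C)
  exact (H h j).2.trans (mul_le_mul_of_nonneg_left (tailWeight_mul_step_le h0 hh h1 j) hC.le)

/-- The tail weight varies by a bounded factor over distances at most 2, however many mesh points
such a distance contains. -/
theorem exists_M_comparable (h0 : 0 < α) (h2 : α < 2) : ∃ L : ℝ, 0 < L ∧ ∀ h : ℝ, 0 < h →
    ∀ j i : ℤ, |(i : ℝ)| * h ≤ 2 → M α h (j + i) ≤ L * M α h j := by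
  obtain ⟨c, C, hc, hC, H⟩ := exists_M_bounds h0 h2
  refine ⟨C * 3 ^ (1 + α) / c, by positivity, fun h hh j i hi => ?_⟩
  have h1 := tailWeight_sub_le h0 (u := ((j + i : ℤ) : ℝ) * h) (v := j * h) (r := 2)
    (by norm_num) (by
      rw [show (j : ℝ) * h - ((j + i : ℤ) : ℝ) * h = -(i * h) by push_cast; ring, abs_neg, abs_mul,
        abs_of_pos hh]
      exact hi)
  rw [show (1 : ℝ) + 2 = 3 by norm_num] at h1
  have h3 := (H h j).1
  rw [div_mul_eq_mul_div, le_div_iff₀ hc]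
  have hp : (0 : ℝ) < 3 ^ (1 + α) := by positivity
  calc M α h (j + i) * c ≤ C * tailWeight α (((j + i : ℤ) : ℝ) * h) * c :=
        mul_le_mul_of_nonneg_right (H h (j + i)).2 hc.le
    _ ≤ C * (3 ^ (1 + α) * tailWeight α (j * h)) * c := by gcongr
    _ = C * 3 ^ (1 + α) * (c * tailWeight α (j * h)) := by ring
    _ ≤ _ := by gcongr

/-- This is the hypothesis of the abstract Poincaré inequality. It is `tailWeight_mul_le` at u = jh,
v = (j − l)h, the weight at v being at most |v|^(−1−α) and so at most a multiple of β_{l−j}. -/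
theorem exists_M_mul_M_le (h0 : 0 < α) (h2 : α < 2) : ∃ A : ℝ, 0 < A ∧ ∀ h : ℝ, 0 < h →
    ∀ j l : ℤ, j ≠ l → M α h j * M α h l ≤ A * beta α h (l - j) * (M α h j + M α h l) := by
  obtain ⟨c, C, hc, hC, H⟩ := exists_M_bounds h0 h2
  obtain ⟨b, B, hb, Hb⟩ := beta_bounds h0 h2
  refine ⟨C * C * 2 ^ (1 + α) / (b * c), by positivity, fun h hh j l hjl => ?_⟩
  have hlj : l - j ≠ 0 := sub_ne_zero.2 hjl.symm
  have hr : ((l - j : ℤ) : ℝ) ≠ 0 := by exact_mod_cast hlj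
  have h1 := (Hb h hh (l - j) hlj).1
  have h3 := tailWeight_mul_le h0 (j * h) ((j - l : ℝ) * h)
  rw [show (j - l : ℝ) * h - j * h = -(l * h) by ring, tailWeight_neg] at h3
  have h4 : tailWeight α ((j - l : ℝ) * h) ≤ (|((l - j : ℤ) : ℝ)| * h) ^ (-1 - α) := by
    have := tailWeight_le_rpow h0 (x := (j - l : ℝ) * h)
      (mul_ne_zero (by push_cast at hr; exact sub_ne_zero.2 (sub_ne_zero.1 hr).symm) hh.ne')
    rw [abs_mul, abs_of_pos hh, abs_sub_comm] at this
    push_cast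
    exact this
  have hj := H h j
  have hl := H h l
  have wj := tailWeight_pos α (j * h)
  have wl := tailWeight_pos α (l * h)
  have w0 := tailWeight_pos α ((j - l : ℝ) * h)
  have h5 : b * tailWeight α ((j - l : ℝ) * h) ≤ beta α h (l - j) :=
    (mul_le_mul_of_nonneg_left h4 hb.le).trans h1
  rw [div_mul_eq_mul_div, div_mul_eq_mul_div, le_div_iff₀ (by positivity)]
  calc M α h j * M α h l * (b * c)
      ≤ (C * tailWeight α (j * h)) * (C * tailWeight α (l * h)) * (b * c) := by
        gcongr
        · exact (M_pos h0 h2 h l).le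
        · exact hj.2
        · exact hl.2
    _ = C * C * (tailWeight α (j * h) * tailWeight α (l * h)) * (b * c) := by ring
    _ ≤ C * C * (2 ^ (1 + α) * tailWeight α ((j - l : ℝ) * h) *
          (tailWeight α (j * h) + tailWeight α (l * h))) * (b * c) := by gcongr
    _ = C * C * 2 ^ (1 + α) * (b * tailWeight α ((j - l : ℝ) * h)) *
          (c * tailWeight α (j * h) + c * tailWeight α (l * h)) := by ring
    _ ≤ _ := by
        have : (0 : ℝ) ≤ C * C * 2 ^ (1 + α) := by positivity
        exact mul_le_mul (mul_le_mul_of_nonneg_left h5 this) (add_le_add hj.1 hl.1)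
          (by positivity) (mul_nonneg this (beta_nonneg h0 h2 hh _))

/-- At least 1/h mesh points lie in [0, 1], where the tail weight equals 1. The lower bound keeps
the Poincaré constant bounded as h → 0. -/
theorem exists_mass_ge (h0 : 0 < α) (h2 : α < 2) : ∃ c : ℝ, 0 < c ∧ ∀ h : ℝ, 0 < h → h < 1 →
    c ≤ (∑' j, M α h j) * h := by
  obtain ⟨c, C, hc, hC, H⟩ := exists_M_bounds h0 h2
  refine ⟨c, hc, fun h hh h1 => ?_⟩
  set N := ⌊1 / h⌋₊
  have hsum := (summable_M h0 h2 hh h1).sum_le_tsum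
    ((Finset.range (N + 1)).map ⟨fun n : ℕ => (n : ℤ), Nat.cast_injective⟩)
    fun j _ => (M_pos h0 h2 h j).le
  rw [Finset.sum_map] at hsum
  have hlow : ∑ n ∈ Finset.range (N + 1), c ≤ ∑ n ∈ Finset.range (N + 1), M α h (n : ℤ) := by
    refine Finset.sum_le_sum fun n hn => ?_
    have hn' : (n : ℝ) ≤ 1 / h := by
      have h3 : n ≤ N := by have := Finset.mem_range.1 hn; omega
      exact (Nat.cast_le.2 h3).trans (Nat.floor_le (by positivity))
    rw [le_div_iff₀ hh] at hn'
    have := (H h n).1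
    have hw : tailWeight α (((n : ℤ) : ℝ) * h) = 1 := by
      rw [tailWeight, Int.cast_natCast, abs_of_nonneg (by positivity), max_eq_left hn',
        Real.one_rpow]
    rwa [hw, mul_one] at this
  rw [Finset.sum_const, Finset.card_range, nsmul_eq_mul] at hlow
  have hN : 1 / h ≤ ((N + 1 : ℕ) : ℝ) := by push_cast; exact (Nat.lt_floor_add_one _).le
  rw [div_le_iff₀ hh] at hN
  have h5 := mul_le_mul_of_nonneg_right (hlow.trans hsum) hh.le
  nlinarith

theorem summable_dirTerm_M (h0 : 0 < α) (h2 : α < 2) {h : ℝ} (hh : 0 < h) (h1 : h < 1) {f : ℤ → ℝ}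
    (hf : Summable fun j => f j ^ 2 / M α h j) :
    Summable (dirTerm (M α h) (beta α h) f) := by
  obtain ⟨c, C, hc, hC, H⟩ := exists_M_bounds h0 h2
  obtain ⟨b, B, hb, Hb⟩ := beta_bounds h0 h2
  -- `beta_bounds` does not assert a sign for its upper constant, hence the absolute value.
  set D1 := |B| * h ^ (-1 - α) with hD1
  have hD10 : 0 ≤ D1 := by positivity
  set D2 := D1 * (C * (1 / h) ^ (1 + α)) * 2 ^ (1 + α) / c with hD2
  have hW : ∀ x : ℝ, 0 < tailWeight α x := tailWeight_pos α
  have hb1 : ∀ k : ℤ, beta α h k ≤ D1 * tailWeight α k := fun k => by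
    rcases eq_or_ne k 0 with rfl | hk
    · rw [beta_zero]; exact mul_nonneg hD10 (hW _).le
    · have hk1 : (1 : ℝ) ≤ |(k : ℝ)| := by exact_mod_cast Int.one_le_abs hk
      have h3 := (Hb h hh k hk).2
      have e : tailWeight α k = |(k : ℝ)| ^ (-1 - α) := by rw [tailWeight, max_eq_right hk1]
      rw [Real.mul_rpow (abs_nonneg _) hh.le, ← e] at h3
      refine h3.trans ?_
      rw [hD1]
      have := mul_le_mul_of_nonneg_right (le_abs_self B)
        (mul_nonneg (hW k).le (Real.rpow_nonneg hh.le (-1 - α)))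
      linarith
  refine summable_dirTerm (w := fun k => max D1 D2 * tailWeight α k) (M_pos h0 h2 h)
    (beta_nonneg h0 h2 hh) ((summable_tailWeight_int h0).mul_left _)
    (fun k => mul_nonneg (hD10.trans (le_max_left _ _)) (hW _).le)
    (fun k => (hb1 k).trans (mul_le_mul_of_nonneg_right (le_max_left _ _) (hW _).le))
    (fun k l => ?_) hf
  have a1 : M α h (l - k) ≤ C * ((1 / h) ^ (1 + α) * tailWeight α ((l - k : ℤ) : ℝ)) :=
    (H h (l - k)).2.trans (mul_le_mul_of_nonneg_left (tailWeight_mul_step_le h0 hh h1 _) hC.le)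
  have a2 := tailWeight_mul_le h0 (k : ℝ) (l : ℝ)
  have a3 : c * tailWeight α l ≤ M α h l :=
    (mul_le_mul_of_nonneg_left (tailWeight_le_mul_step h0 hh h1 _) hc.le).trans (H h l).1
  push_cast at a1 ⊢
  have hwk := hW k
  have hwl := hW ((l : ℝ) - k)
  have hml := M_pos h0 h2 h l
  calc beta α h k * M α h (l - k)
      ≤ (D1 * tailWeight α k) * (C * ((1 / h) ^ (1 + α) * tailWeight α ((l : ℝ) - k))) :=
        mul_le_mul (hb1 k) a1 (M_pos h0 h2 h _).le (mul_nonneg hD10 hwk.le)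
    _ = D1 * (C * (1 / h) ^ (1 + α)) * (tailWeight α k * tailWeight α ((l : ℝ) - k)) := by ring
    _ ≤ D1 * (C * (1 / h) ^ (1 + α)) * (2 ^ (1 + α) * tailWeight α l *
          (tailWeight α k + tailWeight α ((l : ℝ) - k))) :=
        mul_le_mul_of_nonneg_left a2 (by positivity)
    _ = (c * tailWeight α l) * (D2 * (tailWeight α k + tailWeight α ((l : ℝ) - k))) := by
        rw [hD2]; field_simp
    _ ≤ M α h l * (max D1 D2 * (tailWeight α k + tailWeight α ((l : ℝ) - k))) := by
        refine mul_le_mul a3 (mul_le_mul_of_nonneg_right (le_max_right _ _) (by positivity)) ?_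
          hml.le
        have : 0 ≤ D2 := by positivity
        positivity
    _ = _ := by ring

theorem memEll2_iff {h : ℝ} {f : ℤ → ℝ} :
    MemEll2 (Minv α h) f ↔ Summable fun j => f j ^ 2 / M α h j := by
  simp only [MemEll2, Minv, div_eq_mul_inv]

theorem ell2Norm_sq (h0 : 0 < α) (h2 : α < 2) {h : ℝ} (hh : 0 < h) (f : ℤ → ℝ) :
    ell2Norm h (Minv α h) f ^ 2 = h * ∑' j, f j ^ 2 / M α h j := by
  have e : ∑' j, f j ^ 2 * Minv α h j * h = h * ∑' j, f j ^ 2 / M α h j := by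
    rw [← tsum_mul_left]
    refine tsum_congr fun j => ?_
    rw [Minv]
    ring
  rw [ell2Norm, Real.sq_sqrt, e]
  rw [e]
  exact mul_nonneg hh.le (tsum_nonneg fun j => div_nonneg (sq_nonneg _) (M_pos h0 h2 h j).le)

theorem symTerm_self (h : ℝ) (f : ℤ → ℝ) :
    symTerm α h f f = fun p => dirTerm (M α h) (beta α h) f p * h ^ 2 := by
  funext p
  simp only [symTerm, dirTerm]
  ring

theorem symForm_self (h : ℝ) (f : ℤ → ℝ) :
    symForm α h f f = h ^ 2 / 2 * ∑' p, dirTerm (M α h) (beta α h) f p := by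
  rw [symForm, symTerm_self, tsum_mul_right]
  ring

theorem symForm_self_nonneg (h0 : 0 < α) (h2 : α < 2) {h : ℝ} (hh : 0 < h) (f : ℤ → ℝ) :
    0 ≤ symForm α h f f := by
  rw [symForm_self]
  exact mul_nonneg (by positivity)
    (tsum_nonneg (dirTerm_nonneg (M_pos h0 h2 h) (beta_nonneg h0 h2 hh)))

theorem proj_sq_div (h0 : 0 < α) (h2 : α < 2) {h : ℝ} (hh : 0 < h) (f : ℤ → ℝ) (j : ℤ) :
    proj α h f j ^ 2 / M α h j = M α h j * ((∑' k, f k) / ∑' k, M α h k) ^ 2 := by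
  have hM := (M_pos h0 h2 h j).ne'
  rw [proj, tsum_mul_right, tsum_mul_right, mul_div_mul_right _ _ hh.ne']
  field_simp

/-- Uniform discrete fractional Poincaré inequality. -/
theorem exists_poincare (h0 : 0 < α) (h2 : α < 2) : ∃ P : ℝ, 0 < P ∧ ∀ h : ℝ, 0 < h → h < 1 →
    ∀ f : ℤ → ℝ, MemEll2 (Minv α h) f →
      ell2Norm h (Minv α h) f ^ 2 ≤
        P * (symForm α h f f + ell2Norm h (Minv α h) (proj α h f) ^ 2) := by
  obtain ⟨A, hA, HA⟩ := exists_M_mul_M_le h0 h2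
  obtain ⟨c, hc, Hc⟩ := exists_mass_ge h0 h2
  refine ⟨max 1 (2 * A / c), by positivity, fun h hh h1 f hf => ?_⟩
  rw [memEll2_iff] at hf
  have hM := M_pos h0 h2 h
  have hMs := summable_M h0 h2 hh h1
  have key := tsum_sq_div_le_dirTerm hM hMs (fun k => beta_neg h k) (HA h hh) hf
    (summable_dirTerm_M h0 h2 hh h1 hf)
  have hS0 := symForm_self_nonneg h0 h2 hh f
  have hmass := Hc h hh h1
  have hpsq : 0 ≤ ell2Norm h (Minv α h) (proj α h f) ^ 2 := sq_nonneg _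
  have hproj : ell2Norm h (Minv α h) (proj α h f) ^ 2 =
      h * (∑' k, f k) ^ 2 / ∑' k, M α h k := by
    have hm0 : (∑' k, M α h k) ≠ 0 := fun h3 => by rw [h3, zero_mul] at hmass; linarith
    rw [ell2Norm_sq h0 h2 hh]
    simp only [proj_sq_div h0 h2 hh, tsum_mul_right]
    field_simp
  set m := ∑' k, M α h k with hm
  have hm0 : 0 < m := by
    by_contra h3
    nlinarith
  have hN : ell2Norm h (Minv α h) f ^ 2 ≤
      ell2Norm h (Minv α h) (proj α h f) ^ 2 + 2 * A / c * symForm α h f f := by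
    have h5 : ell2Norm h (Minv α h) f ^ 2 ≤
        ell2Norm h (Minv α h) (proj α h f) ^ 2 + 2 * A / (m * h) * symForm α h f f := by
      rw [hproj, ell2Norm_sq h0 h2 hh, symForm_self]
      have e : h * (∑' k, f k) ^ 2 / m + 2 * A / (m * h) *
          (h ^ 2 / 2 * ∑' p, dirTerm (M α h) (beta α h) f p) =
          h * (((∑' k, f k) ^ 2 + A * ∑' p, dirTerm (M α h) (beta α h) f p) / m) := by
        field_simp
      rw [e]
      refine mul_le_mul_of_nonneg_left ?_ hh.le
      rw [le_div_iff₀ hm0]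
      linarith
    refine h5.trans (add_le_add_right (mul_le_mul_of_nonneg_right ?_ hS0) _)
    exact div_le_div_of_nonneg_left (by positivity) hc hmass
  have p1 := mul_le_mul_of_nonneg_right (le_max_left 1 (2 * A / c)) hpsq
  have p2 := mul_le_mul_of_nonneg_right (le_max_right 1 (2 * A / c)) hS0
  linarith

/-- The inverse inequality: besides membership, it covers the interpolation estimate when δ is below
the mesh size. -/
theorem memEll2_D (h0 : 0 < α) (h2 : α < 2) : ∃ L : ℝ, 0 < L ∧ ∀ h : ℝ, 0 < h → h < 1 →
    ∀ f : ℤ → ℝ, MemEll2 (Minv α h) f → MemEll2 (Minv α h) (D h f) ∧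
      ell2Norm h (Minv α h) (D h f) ^ 2 ≤ L / h ^ 2 * ell2Norm h (Minv α h) f ^ 2 := by
  obtain ⟨L, hL, HL⟩ := exists_M_comparable h0 h2
  refine ⟨L, hL, fun h hh h1 f hf => ?_⟩
  rw [memEll2_iff] at hf
  obtain ⟨hs, hle⟩ := summable_sq_D_div (M_pos h0 h2 h) (L := L) hh (fun j =>
    ⟨HL h hh j 1 (by norm_num; linarith), HL h hh j (-1) (by norm_num; linarith)⟩) hf
  refine ⟨memEll2_iff.2 hs, ?_⟩
  rw [ell2Norm_sq h0 h2 hh, ell2Norm_sq h0 h2 hh]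
  have := mul_le_mul_of_nonneg_left hle hh.le
  linarith

/-- Uniform interpolation inequality for the centred difference at the scale `δ`. -/
theorem exists_interpolation (h0 : 0 < α) (h2 : α < 2) : ∃ K : ℝ, 0 < K ∧ ∀ δ : ℝ, 0 < δ → δ ≤ 1 →
    ∀ h : ℝ, 0 < h → h < 1 → ∀ f : ℤ → ℝ, MemEll2 (Minv α h) f →
      ell2Norm h (Minv α h) (D h f) ^ 2 ≤ K * δ ^ α * symForm α h (D h f) (D h f) +
        K / δ ^ 2 * ell2Norm h (Minv α h) f ^ 2 := by
  obtain ⟨L, hL, HL⟩ := exists_M_comparable h0 h2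
  obtain ⟨b, B, hb, Hb⟩ := beta_bounds h0 h2
  obtain ⟨L', hL', HD⟩ := memEll2_D h0 h2
  refine ⟨8 * L ^ 4 / b + 32 * L ^ 3 + L', by positivity, fun δ hδ hδ1 h hh h1 f hf => ?_⟩
  set K := 8 * L ^ 4 / b + 32 * L ^ 3 + L' with hK
  have hK0 : 0 < K := by positivity
  have hS0 := symForm_self_nonneg h0 h2 hh (D h f)
  have hN0 : 0 ≤ ell2Norm h (Minv α h) f ^ 2 := sq_nonneg _
  have hDf := HD h hh h1 f hf
  -- If δ < h there is no block to average over, but then 1/h² ≤ 1/δ² and the inverse inequality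
  -- suffices.
  rcases lt_or_ge δ h with hlt | hge
  · refine hDf.2.trans ?_
    have h3 : L' / h ^ 2 ≤ K / δ ^ 2 :=
      div_le_div₀ hK0.le (by rw [hK]; linarith [(by positivity : 0 < 8 * L ^ 4 / b + 32 * L ^ 3)])
        (by positivity) (pow_le_pow_left₀ hδ.le hlt.le 2)
    have h4 := mul_le_mul_of_nonneg_right h3 hN0
    have h5 : 0 ≤ K * δ ^ α * symForm α h (D h f) (D h f) := by positivity
    linarith
  -- The block length satisfies δ/2 ≤ R h ≤ δ. Jumps within it have rate at least b δ^(−1−α), and (R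
  -- + 1) h ≤ 2 makes M comparable across it. The coefficient 1 / (R h δ^(−1−α)) is then of order
  -- δ^α.
  · set R := ⌊δ / h⌋₊ with hR
    have hR1 : 1 ≤ R := Nat.le_floor (by rw [Nat.cast_one, le_div_iff₀ hh]; linarith)
    have hR1' : (1 : ℝ) ≤ R := by exact_mod_cast hR1
    have hRle : (R : ℝ) * h ≤ δ := by
      have := Nat.floor_le (div_nonneg hδ.le hh.le)
      rwa [le_div_iff₀ hh] at this
    have hRge : δ / 2 ≤ (R : ℝ) * h := by
      have := Nat.lt_floor_add_one (δ / h)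
      rw [div_lt_iff₀ hh] at this
      have h3 : (R : ℝ) + 1 ≤ 2 * R := by linarith
      have h4 := mul_le_mul_of_nonneg_right h3 hh.le
      rw [← hR] at this
      linarith
    have hRh : 0 < (R : ℝ) * h := by positivity
    have hBpos : 0 < b * δ ^ (-1 - α) := by positivity
    rw [memEll2_iff] at hf
    have hs := memEll2_iff.1 hDf.1
    have key := tsum_sq_D_div_le (M_pos h0 h2 h) (beta_nonneg h0 h2 hh) hh hL hBpos hR1
      (fun j i hi0 hi1 => by
        have hi0' : (0 : ℝ) ≤ i := by exact_mod_cast hi0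
        have hi1' : (i : ℝ) ≤ R + 1 := by exact_mod_cast hi1
        have hih : |(i : ℝ)| * h ≤ 2 := by
          rw [abs_of_nonneg hi0']
          have := mul_le_mul_of_nonneg_right hi1' hh.le
          linarith
        refine ⟨HL h hh j i hih, ?_⟩
        have := HL h hh (j + i) (-i) (by push_cast; rwa [abs_neg])
        rwa [add_neg_cancel_right] at this)
      (fun k hk1 hkR => by
        have hk1' : (1 : ℝ) ≤ k := by exact_mod_cast hk1
        have hkR' : (k : ℝ) ≤ R := by exact_mod_cast hkR
        refine le_trans (mul_le_mul_of_nonneg_left ?_ hb.le) (Hb h hh k (by omega)).1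
        rw [abs_of_pos (by linarith)]
        refine Real.rpow_le_rpow_of_nonpos (by positivity) ?_ (by linarith)
        exact (mul_le_mul_of_nonneg_right hkR' hh.le).trans hRle)
      hf hs (summable_dirTerm_M h0 h2 hh h1 hs)
    have key2 := mul_le_mul_of_nonneg_left key hh.le
    rw [← ell2Norm_sq h0 h2 hh] at key2
    have e : h * (2 * L ^ 4 / (R * (b * δ ^ (-1 - α))) *
        ∑' p, dirTerm (M α h) (beta α h) (D h f) p +
        8 * L ^ 3 / (R * h) ^ 2 * ∑' j, f j ^ 2 / M α h j) =
        4 * L ^ 4 / b / ((R * h) * δ ^ (-1 - α)) * symForm α h (D h f) (D h f) +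
        8 * L ^ 3 / (R * h) ^ 2 * ell2Norm h (Minv α h) f ^ 2 := by
      rw [symForm_self, ell2Norm_sq h0 h2 hh]
      field_simp
      ring
    rw [e] at key2
    refine key2.trans (add_le_add (mul_le_mul_of_nonneg_right ?_ hS0)
      (mul_le_mul_of_nonneg_right ?_ hN0))
    · have e1 : δ * δ ^ (-1 - α) = (δ ^ α)⁻¹ := by
        rw [show δ * δ ^ (-1 - α) = δ ^ (1 : ℝ) * δ ^ (-1 - α) by rw [Real.rpow_one],
          ← Real.rpow_add hδ, ← Real.rpow_neg hδ.le]
        congr 1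
        ring
      have hp : 0 < δ ^ (-1 - α) := by positivity
      have e2 : (δ ^ α)⁻¹ / 2 ≤ (R * h) * δ ^ (-1 - α) := by
        rw [← e1]
        have := mul_le_mul_of_nonneg_right hRge hp.le
        linarith
      have hα : 0 < δ ^ α := by positivity
      calc 4 * L ^ 4 / b / ((R * h) * δ ^ (-1 - α)) ≤ 4 * L ^ 4 / b / ((δ ^ α)⁻¹ / 2) :=
            div_le_div_of_nonneg_left (by positivity) (by positivity) e2
        _ = 8 * L ^ 4 / b * δ ^ α := by
            field_simp
            ring
        _ ≤ K * δ ^ α := by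
            refine mul_le_mul_of_nonneg_right ?_ hα.le
            rw [hK]
            linarith [(by positivity : 0 < 32 * L ^ 3)]
    · calc 8 * L ^ 3 / (R * h) ^ 2 ≤ 8 * L ^ 3 / (δ / 2) ^ 2 :=
            div_le_div_of_nonneg_left (by positivity) (by positivity)
              (pow_le_pow_left₀ (by positivity) hRge 2)
        _ = 32 * L ^ 3 / δ ^ 2 := by
            field_simp
            ring
        _ ≤ K / δ ^ 2 := by
            refine div_le_div_of_nonneg_right ?_ (by positivity)
            rw [hK]
            linarith [(by positivity : 0 < 8 * L ^ 4 / b)]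

theorem memEll2_proj (h0 : 0 < α) (h2 : α < 2) {h : ℝ} (hh : 0 < h) (h1 : h < 1) (f : ℤ → ℝ) :
    MemEll2 (Minv α h) (proj α h f) := by
  rw [memEll2_iff]
  simp only [proj_sq_div h0 h2 hh]
  exact (summable_M h0 h2 hh h1).mul_right _

end

end LevyFP

end

/-! ### Conclusion: Young, interpolation at a small scale, and Poincaré. -/

theorem mainTheorem9 (α : ℝ) (hα0 : 0 < α) (hα2 : α < 2) :
    ∃ η : ℝ, 0 < η ∧ ∃ h₀ : ℝ, 0 < h₀ ∧
      ∀ ε : ℝ, 0 < ε → ε < η → ∃ K : ℝ, 0 < K ∧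
        ∀ h : ℝ, 0 < h → h < h₀ →
          (∀ j : ℤ, 0 < LevyFP.M α h j) ∧ Summable (LevyFP.M α h) ∧
          ∀ f : ℤ → ℝ, LevyFP.MemEll2 (LevyFP.Minv α h) f →
            Summable f ∧
            LevyFP.MemEll2 (LevyFP.Minv α h) (LevyFP.D h f) ∧
            LevyFP.MemEll2 (LevyFP.Minv α h) (LevyFP.proj α h f) ∧
            Summable (LevyFP.symTerm α h f f) ∧
            Summable (LevyFP.symTerm α h (LevyFP.D h f) (LevyFP.D h f)) ∧
            LevyFP.ell2Norm h (LevyFP.Minv α h) f *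
                LevyFP.ell2Norm h (LevyFP.Minv α h) (LevyFP.D h f) +
              LevyFP.ell2Norm h (LevyFP.Minv α h) (LevyFP.D h f) ^ 2 ≤
            K * (LevyFP.symForm α h f f +
                LevyFP.ell2Norm h (LevyFP.Minv α h) (LevyFP.proj α h f) ^ 2) +
              ε * LevyFP.symForm α h (LevyFP.D h f) (LevyFP.D h f) := by
  obtain ⟨P, hP, HP⟩ := LevyFP.exists_poincare hα0 hα2
  obtain ⟨Q, hQ, HQ⟩ := LevyFP.exists_interpolation hα0 hα2
  obtain ⟨L, -, HD⟩ := LevyFP.memEll2_D hα0 hα2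
  refine ⟨1, one_pos, 1, one_pos, fun ε hε _ => ?_⟩
  -- Young's inequality leaves 3/2 in front of ‖D_h f‖², so δ is chosen to make 3/2 of the
  -- interpolation coefficient at most ε.
  obtain ⟨δ, hδ, hδ1, hδε⟩ : ∃ δ : ℝ, 0 < δ ∧ δ ≤ 1 ∧ 3 / 2 * (Q * δ ^ α) ≤ ε := by
    have hx : 0 < 2 * ε / (3 * Q) := by positivity
    refine ⟨min 1 ((2 * ε / (3 * Q)) ^ (1 / α)), by positivity, min_le_left _ _, ?_⟩
    have h1 : (min 1 ((2 * ε / (3 * Q)) ^ (1 / α))) ^ α ≤ 2 * ε / (3 * Q) := by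
      refine (Real.rpow_le_rpow (by positivity) (min_le_right _ _) hα0.le).trans_eq ?_
      rw [← Real.rpow_mul hx.le, one_div_mul_cancel hα0.ne', Real.rpow_one]
    rw [le_div_iff₀ (by positivity)] at h1
    linarith
  -- The bracket is the total coefficient of ‖f‖²: 1/2 from Young and 3/2 · Q/δ² from interpolation.
  -- P converts it by Poincaré.
  refine ⟨(1 / 2 + 3 / 2 * (Q / δ ^ 2)) * P, by positivity, fun h hh h1 =>
    ⟨LevyFP.M_pos hα0 hα2 h, LevyFP.summable_M hα0 hα2 hh h1, fun f hf => ?_⟩⟩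
  have hf' := LevyFP.memEll2_iff.1 hf
  have hD := (HD h hh h1 f hf).1
  refine ⟨LevyFP.summable_of_sq_div (LevyFP.M_pos hα0 hα2 h)
    (LevyFP.summable_M hα0 hα2 hh h1) hf', hD, LevyFP.memEll2_proj hα0 hα2 hh h1 f, ?_, ?_, ?_⟩
  · rw [LevyFP.symTerm_self]
    exact (LevyFP.summable_dirTerm_M hα0 hα2 hh h1 hf').mul_right _
  · rw [LevyFP.symTerm_self]
    exact (LevyFP.summable_dirTerm_M hα0 hα2 hh h1 (LevyFP.memEll2_iff.1 hD)).mul_right _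
  · have hp := HP h hh h1 f hf
    have hi := HQ δ hδ hδ1 h hh h1 f hf
    have hS := LevyFP.symForm_self_nonneg hα0 hα2 hh (LevyFP.D h f)
    set a := LevyFP.ell2Norm h (LevyFP.Minv α h) f
    set d := LevyFP.ell2Norm h (LevyFP.Minv α h) (LevyFP.D h f)
    have h3 : a * d ≤ 1 / 2 * a ^ 2 + 1 / 2 * d ^ 2 := by nlinarith [sq_nonneg (a - d)]
    have h4 := mul_le_mul_of_nonneg_right hδε hS
    have h5 := mul_le_mul_of_nonneg_left hp
      (by positivity : 0 ≤ 1 / 2 + 3 / 2 * (Q / δ ^ 2))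
    linarith
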